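/- Let $T$ be a $(d_0,d_1)$-semi-regular tree with $d_0,d_1\ge 4$: there is a bipartition $V(T)=V_0\sqcup V_1$ such that every edge has one end in each part and every vertex of $V_t$ has degree $d_t$. Let $\mathrm{Aut}(T)$ carry the topology of pointwise convergence on vertices. Let $d$ be the graph distance and $S(v,r)=\{w : d(v,w)=r\}$. Let $i:V(T)\to\mathbb N$ be a legal coloring: $i$ maps $V_0$ to $\{1,\dots,d_1\}$ and $V_1$ to $\{1,\dots,d_0\}$, and for $t\in\{0,1\}$ and $v\in V_t$ it restricts to a bijection $S(v,1)\to\{1,\dots,d_t\}$. For $g\in\mathrm{Aut}(T)$ and $v\in V(T)$ put $\sigma_{(i)}(g,v)=i|_{S(gv,1)}\circ g\circ (i|_{S(v,1)})^{-1}$, a permutation of $\{1,\dots,d_t\}$ for $v\in V_t$, and for a finite set $B$ of vertices put $\mathrm{Sgn}_{(i)}(g,B)=\prod_{w\in B}\mathrm{sgn}\,\sigma_{(i)}(g,w)$. Let $Y_0,Y_1\subseteq\mathbb N=\{0,1,2,\dots\}$ be finite, possibly empty sets, and write $S_Y(v)=\bigcup_{r\in Y}S(v,r)$. With $\max\varnothing=0$,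 $t_0=\max(Y_0)\bmod 2$ and $t_1=(1+\max(Y_1))\bmod 2$, let $G=G^+_{(i)}(Y_0,Y_1)$ be the group of all automorphisms $g$ of $T$ that preserve $V_0$ and $V_1$ and satisfy $\mathrm{Sgn}_{(i)}(g,S_{Y_0}(v))=1$ for all $v\in V_{t_0}$ and $\mathrm{Sgn}_{(i)}(g,S_{Y_1}(v))=1$ for all $v\in V_{t_1}$. Let $\mathcal S_0$ be the set of the pointwise fixators in $G$ of the balls $B_T(v,r)$ ($v$ a vertex, $r\ge1$) and $B_T(e,r)$ ($e$ an edge, $r\ge0$), where $B_T(e,r)$ consists of the vertices at distance at most $r$ from an end of $e$. For a set $\mathcal S$ of subgroups of $G$, order the set $\mathcal F_{\mathcal S}$ of the conjugacy classes $\mathcal C(U)$, $U\in\mathcal S$, by: $\mathcal C(U)\le\mathcal C(V)$ if some conjugate of $V$ is contained in some conjugate of $U$. The height of an element is the supremum of the lengths $n$ of chains $x_0<x_1<\dots<x_n$ ending at or below it. Call $\mathcal S$ a generic filtration of $G$ if it is a basis of neighbourhoods of the identity consisting of compact open subgroups and every element of $\mathcal F_{\mathcal S}$ has finite height; then $\mathcal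 S[l]$ is the set of those $U\in\mathcal S$ for which $\mathcal C(U)$ has height $l$. **Theorem.** $G$ is a non-discrete, unimodular, totally disconnected, second-countable, locally compact Hausdorff group, $\mathcal S_0$ is a generic filtration of $G$, and $\mathcal S_0$ factorizes$^+$ at every depth $l\ge1$, that is, for every $l\ge 1$ and every $U\in\mathcal S_0[l]$: 1. for every conjugate $V$ of an element of $\mathcal S_0$ with $V\not\subseteq U$ there is a conjugate $W$ of an element of $\mathcal S_0[l-1]$ with $U\subseteq W\subseteq VU=\{vu : v\in V,\ u\in U\}$; 2. for every conjugate $V$ of an element of $\mathcal S_0$ the set $N_G(U,V)=\{g\in G : g^{-1}Vg\subseteq U\}$ is compact; 3. every conjugate $W$ of an element of $\mathcal S_0[l-1]$ with $U\subseteq W$ satisfies $W\subseteq N_G(U,U)=\{g\in G : g^{-1}Ug\subseteq U\}$. -/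

import Mathlib

open scoped Pointwise

namespace RaduTree

universe u

section Filtrations

variable {G : Type u} [Group G]

/-- The conjugacy class `𝒞(U)` of a subgroup `U` of `G`. -/
def conjClass (U : Subgroup G) : Set (Subgroup G) :=
  {V | ∃ g : G, V = MulAut.conj g • U}

theorem self_mem_conjClass (U : Subgroup G) : U ∈ conjClass U :=
  ⟨1, by simp⟩

/-- The set `𝓕_S = {𝒞(U) | U ∈ S}` of conjugacy classes of members of `S`. -/
def ClassPoset (S : Set (Subgroup G)) : Type u :=
  {C : Set (Subgroup G) // ∃ U ∈ S, C = conjClass U}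

/-- `𝓕_S` is ordered by reverse inclusion of representatives: `C ≤ D` if some representative of `D`
is contained in some representative of `C`. -/
instance (S : Set (Subgroup G)) : Preorder (ClassPoset S) where
  le C D := ∃ U ∈ C.1, ∃ V ∈ D.1, V ≤ U
  le_refl C := by
    obtain ⟨C, U, hU, rfl⟩ := C
    exact ⟨U, self_mem_conjClass U, U, self_mem_conjClass U, le_rfl⟩
  le_trans C D E := by
    obtain ⟨C, A, hA, rfl⟩ := C
    obtain ⟨D, B, hB, rfl⟩ := D
    obtain ⟨E, F, hF, rfl⟩ := E
    rintro ⟨U, hU, V, ⟨g, rfl⟩, hVU⟩ ⟨V', ⟨h, rfl⟩, W, ⟨k, rfl⟩, hW⟩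
    refine ⟨U, hU, MulAut.conj (g * h⁻¹ * k) • F, ⟨_, rfl⟩, le_trans ?_ hVU⟩
    have h1 := Subgroup.pointwise_smul_le_pointwise_smul_iff (a := MulAut.conj (g * h⁻¹)) |>.2 hW
    rw [smul_smul, smul_smul, ← map_mul, ← map_mul] at h1
    simpa using h1

/-- The class in `𝓕_S` of a member `U` of `S`. -/
def ClassPoset.mk {S : Set (Subgroup G)} (U : Subgroup G) (hU : U ∈ S) : ClassPoset S :=
  ⟨conjClass U, U, hU, rfl⟩

/-- `S[l]`: the members `U` of `S` at depth `l`, i.e. such that `𝒞(U)` has height `l` in `𝓕_S`. -/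
def depthSet (S : Set (Subgroup G)) (l : ℕ) : Set (Subgroup G) :=
  {U | ∃ hU : U ∈ S, Order.height (ClassPoset.mk U hU) = l}

/-- The subgroups which are conjugate to a member of `R`. -/
def conjugates (R : Set (Subgroup G)) : Set (Subgroup G) :=
  {V | ∃ U ∈ R, V ∈ conjClass U}

/-- `N_G(U, V) = {g ∈ G | g⁻¹ V g ⊆ U}`. -/
def transporter (U V : Subgroup G) : Set G :=
  {g | ∀ v ∈ V, g⁻¹ * v * g ∈ U}

variable [TopologicalSpace G]

/-- A generic filtration of `G`: a basis of neighbourhoods of the identity consisting of compact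
open subgroups, such that every element of `𝓕_S` has finite height. -/
structure IsGenericFiltration (S : Set (Subgroup G)) : Prop where
  isOpen : ∀ U ∈ S, IsOpen (U : Set G)
  isCompact : ∀ U ∈ S, IsCompact (U : Set G)
  hasBasis : (nhds (1 : G)).HasBasis (fun U : Subgroup G => U ∈ S) (fun U => (U : Set G))
  height_ne_top : ∀ C : ClassPoset S, Order.height C ≠ ⊤

/-- `S` factorizes at depth `l` (to be used for `l ≥ 1`). -/
structure FactorizesAt (S : Set (Subgroup G)) (l : ℕ) : Prop where
  exists_between : ∀ U ∈ depthSet S l, ∀ V ∈ conjugates S, ¬ V ≤ U →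
    ∃ W ∈ conjugates (depthSet S (l - 1)), U ≤ W ∧ (W : Set G) ⊆ (V : Set G) * (U : Set G)
  isCompact_transporter : ∀ U ∈ depthSet S l, ∀ V ∈ conjugates S, IsCompact (transporter U V)

/-- `S` factorizes⁺ at depth `l` (to be used for `l ≥ 1`). -/
structure FactorizesPlusAt (S : Set (Subgroup G)) (l : ℕ) : Prop extends FactorizesAt S l where
  subset_normalizer : ∀ U ∈ depthSet S l, ∀ W ∈ conjugates (depthSet S (l - 1)), U ≤ W →
    (W : Set G) ⊆ transporter U U

/-- Left Haar measures are right invariant. -/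
def IsUnimodular (G : Type u) [Group G] [TopologicalSpace G] : Prop :=
  ∀ [MeasurableSpace G] [BorelSpace G] (μ : MeasureTheory.Measure G)
    [μ.IsHaarMeasure] [μ.Regular], μ.IsMulRightInvariant

end Filtrations

section Trees

variable {V : Type u} {T : SimpleGraph V}

/-- `Aut(T)` carries the topology of pointwise convergence on the discrete set of vertices. -/
instance autTopology : TopologicalSpace (T ≃g T) :=
  TopologicalSpace.induced (fun g : T ≃g T => (g : V → V))
    (@Pi.topologicalSpace V (fun _ => V) (fun _ => ⊥))

theorem isOpen_apply_eq (v w : V) : IsOpen {g : T ≃g T | g v = w} := by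
  let _ : TopologicalSpace V := ⊥
  have _ : DiscreteTopology V := ⟨rfl⟩
  have h : Continuous (fun g : T ≃g T => (g : V → V) v) :=
    (continuous_apply v).comp continuous_induced_dom
  exact (isOpen_discrete {w}).preimage h

theorem continuous_of_apply {X : Type*} [TopologicalSpace X] {f : X → (T ≃g T)}
    (hf : ∀ x v, ∀ᶠ y in nhds x, f y v = f x v) : Continuous f := by
  let _ : TopologicalSpace V := ⊥
  have _ : DiscreteTopology V := ⟨rfl⟩
  refine continuous_induced_rng.2 (continuous_pi fun v => continuous_iff_continuousAt.2 fun x => ?_)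
  change Filter.Tendsto (fun y => f y v) (nhds x) (nhds (f x v))
  rw [nhds_discrete V, Filter.tendsto_pure]
  exact hf x v

instance : IsTopologicalGroup (T ≃g T) where
  continuous_mul := by
    refine continuous_of_apply fun x v => ?_
    have h1 := ((isOpen_apply_eq (T := T) v (x.2 v)).preimage continuous_snd).mem_nhds
      (x := x) rfl
    have h2 := ((isOpen_apply_eq (T := T) (x.2 v) (x.1 (x.2 v))).preimage continuous_fst).mem_nhds
      (x := x) rfl
    filter_upwards [h1, h2] with y hy1 hy2
    change y.1 (y.2 v) = x.1 (x.2 v)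
    have hy1' : y.2 v = x.2 v := hy1
    rw [hy1']
    exact hy2
  continuous_inv := by
    refine continuous_of_apply fun x v => ?_
    have h1 := (isOpen_apply_eq (T := T) (x⁻¹ v) v).mem_nhds (x := x) (x.apply_symm_apply v)
    filter_upwards [h1] with y hy
    have hy' : y (x⁻¹ v) = v := hy
    change y.symm v = x⁻¹ v
    rw [RelIso.symm_apply_eq, hy']

/-- `S(v, r)`: the vertices at distance `r` from `v`. -/
def sphere (T : SimpleGraph V) (v : V) (r : ℕ) : Set V := {w | T.dist v w = r}

/-- `S_Y(v)`: the vertices whose distance from `v` belongs to `Y`. -/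
def sphereUnion (T : SimpleGraph V) (Y : Finset ℕ) (v : V) : Set V := ⋃ r ∈ Y, sphere T v r

/-- The vertices of the ball `B_T(v, r)` around a vertex. -/
def vertexBall (T : SimpleGraph V) (v : V) (r : ℕ) : Set V := {w | T.dist v w ≤ r}

/-- The vertices of the ball `B_T(e, r)` around an edge: the vertices at distance at most `r` from
one of the ends of `e`. -/
def edgeBall (T : SimpleGraph V) (e : Sym2 V) (r : ℕ) : Set V := {w | ∃ v ∈ e, T.dist v w ≤ r}

/-- The family `𝔗₀` of subtrees (given by their sets of vertices). -/
def subtreeFamily (T : SimpleGraph V) : Set (Set V) :=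
  {A | (∃ v : V, ∃ r : ℕ, 1 ≤ r ∧ A = vertexBall T v r) ∨
    (∃ e ∈ T.edgeSet, ∃ r : ℕ, A = edgeBall T e r)}

/-- `S₀`: the pointwise fixators in `G` of the members of `𝔗₀`. -/
def fixatorFiltration (G : Subgroup (T ≃g T)) : Set (Subgroup G) :=
  {U | ∃ A ∈ subtreeFamily T, U = fixingSubgroup G A}

/-- `T` is a `(d 0, d 1)`-semi-regular tree, with bipartition `V_t = {v | τ v = t}` for
`t = 0, 1`. -/
structure IsSemiRegularTree (T : SimpleGraph V) (τ : T.Coloring (Fin 2)) (d : Fin 2 → ℕ) :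
    Prop where
  isTree : T.IsTree
  degree : ∀ v, (T.neighborSet v).encard = d (τ v)

/-- A legal coloring: vertices of `V₀` get colors in `{1, …, d 1}`, vertices of `V₁` get colors in
`{1, …, d 0}`, and the neighbours of each vertex of `V_t` are colored bijectively by
`{1, …, d t}`. -/
structure LegalColoring (T : SimpleGraph V) (τ : T.Coloring (Fin 2)) (d : Fin 2 → ℕ) where
  color : V → ℕ
  color_mem : ∀ v, color v ∈ Set.Icc 1 (d (1 - τ v))
  bijOn : ∀ v, Set.BijOn color (T.neighborSet v) (Set.Icc 1 (d (τ v)))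

namespace LegalColoring

variable {τ : T.Coloring (Fin 2)} {d : Fin 2 → ℕ} (i : LegalColoring T τ d)

/-- The bijection `i|_{S(v,1)}` from the neighbours of `v` to the colors. -/
noncomputable def nbrEquiv (v : V) : T.neighborSet v ≃ Set.Icc 1 (d (τ v)) :=
  (i.bijOn v).equiv

theorem degree_apply (i : LegalColoring T τ d) (g : T ≃g T) (v : V) : d (τ (g v)) = d (τ v) := by
  have h := Nat.card_congr
    ((i.nbrEquiv (g v)).symm.trans ((g.mapNeighborSet v).symm.trans (i.nbrEquiv v)))
  simpa using h

/-- The local action `σ_(i)(g, v) = i|_{S(gv,1)} ∘ g ∘ (i|_{S(v,1)})⁻¹` of `g` at `v`. -/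
noncomputable def localAction (g : T ≃g T) (v : V) : Equiv.Perm (Set.Icc 1 (d (τ v))) :=
  (i.nbrEquiv v).symm.trans <| (g.mapNeighborSet v).trans <| (i.nbrEquiv (g v)).trans <|
    Equiv.setCongr (by rw [i.degree_apply g v])

/-- The sign of the local action of `g` at `v`. -/
noncomputable def localSign (g : T ≃g T) (v : V) : ℤˣ := Equiv.Perm.sign (i.localAction g v)

/-- `Sgn_(i)(g, B)`, the product over the (finite) set `B` of the signs of the local actions. -/
noncomputable def sgn (g : T ≃g T) (B : Set V) : ℤˣ := ∏ᶠ w ∈ B, i.localSign g w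

theorem localSign_mul (g h : T ≃g T) (v : V) :
    i.localSign (g * h) v = i.localSign g (h v) * i.localSign h v := by
  have hs : Set.Icc 1 (d (τ (h v))) = Set.Icc 1 (d (τ v)) := by rw [i.degree_apply h v]
  have key : i.localAction (g * h) v =
      (((Equiv.setCongr hs).symm.trans (i.localAction g (h v))).trans (Equiv.setCongr hs)) *
        i.localAction h v := by
    ext x
    have hz : (i.nbrEquiv (h v)).symm ((Equiv.setCongr hs).symm (i.localAction h v x)) =
        h.mapNeighborSet v ((i.nbrEquiv v).symm x) :=
      (i.nbrEquiv (h v)).symm_apply_apply _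
    change _ = ((i.nbrEquiv (g (h v))) (g.mapNeighborSet (h v) ((i.nbrEquiv (h v)).symm
      ((Equiv.setCongr hs).symm (i.localAction h v x)))) : ℕ)
    rw [hz]
    rfl
  rw [localSign, key, Equiv.Perm.sign_mul, Equiv.Perm.sign_symm_trans_trans]
  rfl

theorem localSign_one (v : V) : i.localSign 1 v = 1 := by
  have h := i.localSign_mul 1 1 v
  simpa using h

theorem finite_sphere (i : LegalColoring T τ d) (hT : T.IsTree) (v : V) (r : ℕ) : (sphere T v r).Finite := by
  have hc := hT.connected
  induction r with
  | zero =>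
    refine (Set.finite_singleton v).subset fun w hw => ?_
    exact ((hc.dist_eq_zero_iff).1 hw).symm
  | succ r ih =>
    have hn : ∀ w, (T.neighborSet w).Finite := fun w =>
      (i.bijOn w).finite_iff_finite.2 (Set.finite_Icc _ _)
    refine (ih.biUnion fun w _ => hn w).subset fun x hx => ?_
    have hx' : T.dist v x = r + 1 := hx
    obtain ⟨p, hp⟩ := hc.exists_walk_length_eq_dist x v
    rw [SimpleGraph.dist_comm, hx'] at hp
    cases p with
    | nil => simp at hp
    | @cons _ y _ hadj q =>
      simp only [SimpleGraph.Walk.length_cons, Nat.add_right_cancel_iff] at hp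
      have h1 : T.dist y v ≤ r := hp ▸ SimpleGraph.dist_le q
      have h2 : T.dist v x ≤ T.dist v y + T.dist y x := hc.dist_triangle
      have h3 : T.dist y x = 1 := SimpleGraph.dist_eq_one_iff_adj.2 hadj.symm
      rw [SimpleGraph.dist_comm] at h1
      refine Set.mem_biUnion (x := y) ?_ hadj.symm
      change T.dist v y = r
      omega

theorem finite_sphereUnion (i : LegalColoring T τ d) (hT : T.IsTree) (Y : Finset ℕ)
    (v : V) :
    (sphereUnion T Y v).Finite :=
  Y.finite_toSet.biUnion fun r _ => i.finite_sphere hT v r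

end LegalColoring

theorem dist_apply_le (hT : T.IsTree) (g : T ≃g T) (v w : V) : T.dist (g v) (g w) ≤ T.dist v w := by
  obtain ⟨p, hp⟩ := hT.connected.exists_walk_length_eq_dist v w
  rw [← hp, ← SimpleGraph.Walk.length_map g.toHom p]
  exact SimpleGraph.dist_le _

theorem dist_apply (hT : T.IsTree) (g : T ≃g T) (v w : V) : T.dist (g v) (g w) = T.dist v w := by
  refine le_antisymm (dist_apply_le hT g v w) ?_
  simpa using dist_apply_le hT g.symm (g v) (g w)

theorem image_sphereUnion (hT : T.IsTree) (g : T ≃g T) (Y : Finset ℕ) (v : V) :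
    g '' sphereUnion T Y v = sphereUnion T Y (g v) := by
  ext w
  obtain ⟨w, rfl⟩ := g.surjective w
  simp [sphereUnion, sphere, dist_apply hT]

namespace LegalColoring

variable {τ : T.Coloring (Fin 2)} {d : Fin 2 → ℕ} (i : LegalColoring T τ d)

theorem sgn_mul (hT : T.IsTree) (g h : T ≃g T) (Y : Finset ℕ) (v : V) :
    i.sgn (g * h) (sphereUnion T Y v) =
      i.sgn g (sphereUnion T Y (h v)) * i.sgn h (sphereUnion T Y v) := by
  rw [← image_sphereUnion hT h Y v, sgn, sgn, sgn, finprod_mem_image h.injective.injOn,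
    ← finprod_mem_mul_distrib (i.finite_sphereUnion hT Y v)]
  simp only [localSign_mul]

theorem sgn_one (B : Set V) : i.sgn 1 B = 1 := by
  simp [sgn, localSign_one]

end LegalColoring

/-- The group `G⁺_(i)(Y₀, Y₁)` of the type-preserving automorphisms `g` of the tree `T` such that
`Sgn_(i)(g, S_{Y₀}(v)) = 1` for `v ∈ V_{t₀}` and `Sgn_(i)(g, S_{Y₁}(v)) = 1` for `v ∈ V_{t₁}`, where
`t₀ = max Y₀ mod 2` and `t₁ = (1 + max Y₁) mod 2`, with `max ∅ = 0`. -/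
noncomputable def raduGroup (hT : T.IsTree) {τ : T.Coloring (Fin 2)} {d : Fin 2 → ℕ}
    (i : LegalColoring T τ d) (Y₀ Y₁ : Finset ℕ) : Subgroup (T ≃g T) where
  carrier := {g | (∀ v, τ (g v) = τ v) ∧
    (∀ v, (τ v : ℕ) = Y₀.sup id % 2 → i.sgn g (sphereUnion T Y₀ v) = 1) ∧
    (∀ v, (τ v : ℕ) = (1 + Y₁.sup id) % 2 → i.sgn g (sphereUnion T Y₁ v) = 1)}
  mul_mem' := by
    rintro g h ⟨g1, g2, g3⟩ ⟨h1, h2, h3⟩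
    refine ⟨fun v => (g1 (h v)).trans (h1 v), fun v hv => ?_, fun v hv => ?_⟩
    · rw [i.sgn_mul hT, h2 v hv, g2 (h v) (by rw [h1, hv]), one_mul]
    · rw [i.sgn_mul hT, h3 v hv, g3 (h v) (by rw [h1, hv]), one_mul]
  one_mem' := ⟨fun _ => rfl, fun _ _ => i.sgn_one _, fun _ _ => i.sgn_one _⟩
  inv_mem' := by
    rintro g ⟨g1, g2, g3⟩
    have h1 : ∀ v, τ (g⁻¹ v) = τ v := fun v => by
      have h := g1 (g⁻¹ v)
      rwa [show g (g⁻¹ v) = v from g.apply_symm_apply v, eq_comm] at h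
    refine ⟨h1, fun v hv => ?_, fun v hv => ?_⟩
    · have h := i.sgn_mul hT g g⁻¹ Y₀ v
      rwa [mul_inv_cancel, i.sgn_one, g2 (g⁻¹ v) (by rw [h1, hv]), one_mul, eq_comm] at h
    · have h := i.sgn_mul hT g g⁻¹ Y₁ v
      rwa [mul_inv_cancel, i.sgn_one, g3 (g⁻¹ v) (by rw [h1, hv]), one_mul, eq_comm] at h

end Trees

end RaduTree

/-!
The proof rests on one extension principle, `exists_mem_raduGroup_eqOn_biball`: an automorphism
`f` agrees on the union of two balls `A` and `A'` with an element of `G` as soon as it satisfies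
the parity conditions that only involve its values on one of the two balls. Take a parity
condition, at a vertex `u` and with outermost sphere of radius `m`, that is contained in neither
ball. As all degrees are at least four, one can walk `m` steps from `u` away from both centers to
a vertex `w` from which two half-trees avoiding `A ∪ A'` hang (`exists_outward`). Exchanging these
half-trees (`IsSemiRegularTree.exists_swap`) changes the sign at `w`, hence repairs the condition.
If the conditions are treated in the order of the distance of `w` from a base point, a repair does
not disturb the earlier ones: since the outermost spheres of the conditions of kind `j` consist of
vertices of type `j`, the vertex `w` determines the condition that it repairs. Automorphisms with
prescribed values on a nonempty set form a compact set, so it suffices to satisfy finitely many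
conditions at a time (`exists_mem_raduGroup_eqOn`).

The extension principle has three consequences.

* Inclusions of fixators of balls are reversed inclusions of balls (`fixator_le_fixator_iff`), as
  `G` contains elements fixing a ball and moving a given vertex outside it. Hence conjugacy
  classes of fixators are compared by comparing balls. Inclusion of balls increases `l`, strictly
  unless the balls are equal, where `l = 2 r - 1` for a ball of radius `r` around a vertex and
  `l = 2 r` for one around an edge. So the height of the class of a fixator is `l`
  (`height_mk_fixator`).
* The factorization (`exists_factorization`). If `A` is not contained in `A'`, let `R` be obtained
  from `A` by moving the center half an edge towards the center of `A'` and reducing the radius by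
  one half. Some edge in `R` separates `A \ R` from `A' \ R`. An element `g` of `G` fixing `R`
  can thus be replaced by the identity on one side of that edge, which gives an automorphism
  agreeing with `g` on `A` and with the identity on `A'`; the extension principle turns it into an
  element of `G`.
* Vertex stabilizers in `G` are transitive on the neighbours of the vertex
  (`exists_apply_eq_of_adj`). Hence the compact open subgroups of `G` generate `G`, and the
  modular character is trivial.

Finally, an element fixing a ball of depth `l` fixes the center of every ball of depth `l + 1`
containing it (`center_mem_of_subset`) and so preserves this larger ball, which is the normality
statement.
-/

open scoped Pointwise

namespace RaduTree

/-! ### Distances and half-trees in a tree -/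

section TreeGeometry

variable {V : Type*} {T : SimpleGraph V}

theorem dist_succ_or (hT : T.IsTree) (u : V) {v w : V} (h : T.Adj v w) :
    T.dist u v = T.dist u w + 1 ∨ T.dist u w = T.dist u v + 1 := by
  have := hT.dist_eq_dist_add_one_of_adj u h
  omega

theorem exists_adj_dist_succ (hT : T.IsTree) {u x : V} (h : u ≠ x) :
    ∃ p, T.Adj p x ∧ T.dist u x = T.dist u p + 1 := by
  obtain ⟨w, hw⟩ := hT.connected.exists_walk_length_eq_dist x u
  cases w with
  | nil => exact absurd rfl h
  | @cons _ p _ hadj q =>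
    refine ⟨p, hadj.symm, ?_⟩
    have h1 := SimpleGraph.dist_le q
    have h2 := dist_succ_or hT u hadj
    rw [SimpleGraph.Walk.length_cons] at hw
    have h3 := SimpleGraph.dist_comm (G := T) (u := x) (v := u)
    have h4 := SimpleGraph.dist_comm (G := T) (u := p) (v := u)
    omega

theorem adj_dist_succ_unique (hT : T.IsTree) {u x p q : V} (hp : T.Adj p x) (hq : T.Adj q x)
    (hup : T.dist u x = T.dist u p + 1) (huq : T.dist u x = T.dist u q + 1) : p = q := by
  obtain ⟨w₁, h₁⟩ := hT.connected.exists_walk_length_eq_dist u p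
  obtain ⟨w₂, h₂⟩ := hT.connected.exists_walk_length_eq_dist u q
  have e₁ := (w₁.concat hp).isPath_of_length_eq_dist (by simp [h₁, hup])
  have e₂ := (w₂.concat hq).isPath_of_length_eq_dist (by simp [h₂, huq])
  have := (hT.isAcyclic.subsingleton_path u x).elim ⟨_, e₁⟩ ⟨_, e₂⟩
  have h := congrArg (fun P : T.Path u x => (P : T.Walk u x).penultimate) this
  simpa using h

/-- For adjacent vertices `a` and `b`, the half-tree on the side of `b`: the connected component
of `b` once the edge from `a` to `b` is removed. -/
def halfTree (T : SimpleGraph V) (a b : V) : Set V := {x | T.dist b x < T.dist a x}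

theorem mem_halfTree {a b x : V} : x ∈ halfTree T a b ↔ T.dist b x < T.dist a x := Iff.rfl

theorem dist_eq_of_mem_halfTree (hT : T.IsTree) {a b x : V} (hab : T.Adj a b)
    (hx : x ∈ halfTree T a b) : T.dist a x = T.dist b x + 1 := by
  have := dist_succ_or hT x hab
  rw [mem_halfTree] at hx
  rw [SimpleGraph.dist_comm (u := x), SimpleGraph.dist_comm (u := x)] at this
  omega

theorem dist_eq_of_notMem_halfTree (hT : T.IsTree) {a b x : V} (hab : T.Adj a b)
    (hx : x ∉ halfTree T a b) : T.dist b x = T.dist a x + 1 := by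
  have := dist_succ_or hT x hab
  rw [mem_halfTree] at hx
  rw [SimpleGraph.dist_comm (u := x), SimpleGraph.dist_comm (u := x)] at this
  omega

theorem mem_halfTree_symm_iff (hT : T.IsTree) {a b x : V} (hab : T.Adj a b) :
    x ∈ halfTree T b a ↔ x ∉ halfTree T a b := by
  refine ⟨fun h h' => lt_asymm (mem_halfTree.1 h) (mem_halfTree.1 h'), fun h => ?_⟩
  have := dist_eq_of_notMem_halfTree hT hab h
  rw [mem_halfTree]
  omega

/-- The only edge joining a half-tree to its complement is the one that defines it. -/
theorem eq_of_adj_of_mem_halfTree (hT : T.IsTree) {a b x y : V} (hab : T.Adj a b)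
    (hx : x ∈ halfTree T a b) (hy : y ∉ halfTree T a b) (hxy : T.Adj x y) : x = b ∧ y = a := by
  have h1 := dist_eq_of_mem_halfTree hT hab hx
  have h2 := dist_eq_of_notMem_halfTree hT hab hy
  have h3 := dist_succ_or hT a hxy
  have h4 := dist_succ_or hT b hxy
  have hax : T.dist a x = T.dist a y + 1 := by omega
  by_cases hxb : x = b
  · subst hxb
    refine ⟨rfl, ?_⟩
    rw [SimpleGraph.dist_self] at h1
    have : T.dist a y = 0 := by omega
    exact (hT.connected.dist_eq_zero_iff.1 this).symm
  · -- otherwise the neighbour of `x` towards `b` and `y` both precede `x` on the way from `a`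
    exfalso
    obtain ⟨p, hp, hbp⟩ := exists_adj_dist_succ hT (Ne.symm hxb)
    have h5 := dist_succ_or hT a hp
    have h6 := dist_succ_or hT p hab
    rw [SimpleGraph.dist_comm (u := p), SimpleGraph.dist_comm (u := p)] at h6
    have : p = y := adj_dist_succ_unique hT hp hxy.symm (u := a) (by omega) hax
    subst this
    omega

/-- A geodesic entering a half-tree runs through the edge that defines it. -/
theorem dist_eq_of_halfTree (hT : T.IsTree) {a b x y : V} (hab : T.Adj a b)
    (hx : x ∈ halfTree T a b) (hy : y ∉ halfTree T a b) :
    T.dist y x = T.dist y a + 1 + T.dist b x := by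
  have key : ∀ n y, T.dist y x = n → y ∉ halfTree T a b →
      T.dist y x = T.dist y a + 1 + T.dist b x := by
    intro n
    induction n with
    | zero =>
      intro y h hy
      rw [hT.connected.dist_eq_zero_iff] at h
      exact absurd (h ▸ hx) hy
    | succ n ih =>
      intro y h hy
      have hne : x ≠ y := fun h => hy (h ▸ hx)
      obtain ⟨p, hp, hd⟩ := exists_adj_dist_succ hT hne
      have e1 := SimpleGraph.dist_comm (G := T) (u := x) (v := y)
      have e2 := SimpleGraph.dist_comm (G := T) (u := x) (v := p)
      by_cases hpm : p ∈ halfTree T a b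
      · obtain ⟨rfl, rfl⟩ := eq_of_adj_of_mem_halfTree hT hab hpm hy hp
        rw [SimpleGraph.dist_self]
        omega
      · have h1 := ih p (by omega) hpm
        have h2 : T.dist y a ≤ T.dist y p + T.dist p a := hT.connected.dist_triangle
        have h3 : T.dist y p = 1 := SimpleGraph.dist_eq_one_iff_adj.2 hp.symm
        have h4 : T.dist y x ≤ T.dist y a + T.dist a x := hT.connected.dist_triangle
        have h5 := dist_eq_of_mem_halfTree hT hab hx
        omega
  exact key _ y rfl hy

theorem notMem_halfTree_of_dist {a b x : V} (h : T.dist x b = T.dist x a + 1) :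
    x ∉ halfTree T a b := by
  rw [mem_halfTree, SimpleGraph.dist_comm, SimpleGraph.dist_comm (u := a)]
  omega

theorem dist_le_one_iff (hT : T.IsTree) {a b : V} : T.dist a b ≤ 1 ↔ a = b ∨ T.Adj a b := by
  rw [Nat.le_one_iff_eq_zero_or_eq_one, hT.connected.dist_eq_zero_iff,
    SimpleGraph.dist_eq_one_iff_adj]

/-- If `z` and `z'` are neighbours of `u`, each of them closer than `u` to one of two vertices `a`
and `b` that are equal or adjacent, then `z = z'`. -/
theorem eq_of_not_outward (hT : T.IsTree) {a b u z z' : V} (hab : T.dist a b ≤ 1)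
    (hz : T.Adj u z) (hz' : T.Adj u z')
    (h : ¬ (T.dist a z = T.dist a u + 1 ∧ T.dist b z = T.dist b u + 1))
    (h' : ¬ (T.dist a z' = T.dist a u + 1 ∧ T.dist b z' = T.dist b u + 1)) : z = z' := by
  have key : ∀ {a b z z'}, T.dist a b ≤ 1 → T.Adj u z → T.Adj u z' →
      T.dist a u = T.dist a z + 1 → T.dist b u = T.dist b z' + 1 → z = z' := by
    intro a b z z' hab hz hz' ha hb
    by_cases hbz : T.dist b u = T.dist b z + 1
    · exact adj_dist_succ_unique hT hz.symm hz'.symm hbz hb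
    · exfalso
      have hbz' := (dist_succ_or hT b hz).resolve_left hbz
      have ham : a ∈ halfTree T u z := by
        rw [mem_halfTree, SimpleGraph.dist_comm, SimpleGraph.dist_comm (u := u)]
        omega
      have hbm := notMem_halfTree_of_dist hbz'
      rcases (dist_le_one_iff hT).1 hab with rfl | hadj
      · exact hbm ham
      · obtain ⟨-, rfl⟩ := eq_of_adj_of_mem_halfTree hT hz ham hbm hadj
        rw [SimpleGraph.dist_self] at hb
        omega
  have h1 := dist_succ_or hT a hz
  have h2 := dist_succ_or hT b hz
  have h3 := dist_succ_or hT a hz'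
  have h4 := dist_succ_or hT b hz'
  have haa : T.dist a a ≤ 1 := by simp
  have hbb : T.dist b b ≤ 1 := by simp
  have hba : T.dist b a ≤ 1 := by rwa [SimpleGraph.dist_comm]
  by_cases c1 : T.dist a u = T.dist a z + 1 <;> by_cases c2 : T.dist a u = T.dist a z' + 1
  · exact key haa hz hz' c1 c2
  · exact key hab hz hz' c1 (by omega)
  · exact key hba hz hz' (by omega) c2
  · exact key hbb hz hz' (by omega) (by omega)

/-- Every vertex of `T` has at least four neighbours. -/
def HasDegreeGeFour (T : SimpleGraph V) : Prop := ∀ v, 4 ≤ (T.neighborSet v).encard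

theorem HasDegreeGeFour.exists_two_adj (hdeg : HasDegreeGeFour T) (v x y : V) :
    ∃ z₁ z₂, z₁ ≠ z₂ ∧ T.Adj v z₁ ∧ T.Adj v z₂ ∧ z₁ ≠ x ∧ z₁ ≠ y ∧ z₂ ≠ x ∧ z₂ ≠ y := by
  have h1 : 1 < (T.neighborSet v \ {x, y}).encard := by
    by_contra! h
    have h2 : (T.neighborSet v).encard ≤ (T.neighborSet v \ {x, y}).encard +
        ({x, y} : Set V).encard := Set.encard_le_encard_sdiff_add_encard _ _
    have h3 : ({x, y} : Set V).encard ≤ 2 :=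
      (Set.encard_insert_le _ _).trans (by simp [one_add_one_eq_two])
    have h4 := (hdeg v).trans (h2.trans (add_le_add h h3))
    exact absurd h4 (by decide)
  obtain ⟨z₁, z₂, hz₁, hz₂, hne⟩ := Set.one_lt_encard_iff.1 h1
  simp only [Set.mem_sdiff, SimpleGraph.mem_neighborSet, Set.mem_insert_iff,
    Set.mem_singleton_iff, not_or] at hz₁ hz₂
  exact ⟨z₁, z₂, hne, hz₁.1, hz₂.1, hz₁.2.1, hz₁.2.2, hz₂.2.1, hz₂.2.2⟩

/-- From any vertex `u`, one can walk `k + 1` steps straight away from two given centers (each a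
vertex or an edge), with two choices for the last step. -/
theorem exists_outward (hT : T.IsTree) (hdeg : HasDegreeGeFour T) {a b a' b' : V}
    (hab : T.dist a b ≤ 1) (hab' : T.dist a' b' ≤ 1) (u : V) (k : ℕ) :
    ∃ w z₁ z₂, z₁ ≠ z₂ ∧ T.Adj w z₁ ∧ T.Adj w z₂ ∧ T.dist u w = k ∧
      ∀ z, z = z₁ ∨ z = z₂ → T.dist u z = k + 1 ∧
        ∀ x, x = a ∨ x = b ∨ x = a' ∨ x = b' → T.dist x z = T.dist x u + (k + 1) := by
  induction k with
  | zero =>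
    have bad : ∀ {a b}, T.dist a b ≤ 1 → ∃ y, ∀ z, T.Adj u z → z ≠ y →
        (T.dist a z = T.dist a u + 1 ∧ T.dist b z = T.dist b u + 1) := by
      intro a b hab
      by_cases h : ∃ y, T.Adj u y ∧ ¬ (T.dist a y = T.dist a u + 1 ∧ T.dist b y = T.dist b u + 1)
      · obtain ⟨y, hy, hy'⟩ := h
        refine ⟨y, fun z hz hzy => ?_⟩
        by_contra hcon
        exact hzy (eq_of_not_outward hT hab hz hy hcon hy')
      · push Not at h
        exact ⟨u, fun z hz _ => h z hz⟩
    obtain ⟨y, hy⟩ := bad hab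
    obtain ⟨y', hy'⟩ := bad hab'
    obtain ⟨z₁, z₂, hne, h1, h2, h3, h4, h5, h6⟩ := hdeg.exists_two_adj u y y'
    refine ⟨u, z₁, z₂, hne, h1, h2, by simp, ?_⟩
    rintro z (rfl | rfl)
    · refine ⟨by simpa using SimpleGraph.dist_eq_one_iff_adj.2 h1, ?_⟩
      rintro x (rfl | rfl | rfl | rfl)
      exacts [(hy z h1 h3).1, (hy z h1 h3).2, (hy' z h1 h4).1, (hy' z h1 h4).2]
    · refine ⟨by simpa using SimpleGraph.dist_eq_one_iff_adj.2 h2, ?_⟩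
      rintro x (rfl | rfl | rfl | rfl)
      exacts [(hy z h2 h5).1, (hy z h2 h5).2, (hy' z h2 h6).1, (hy' z h2 h6).2]
  | succ k ih =>
    obtain ⟨w, t, _, -, hwt, -, hw, ht⟩ := ih
    obtain ⟨hut, hxt⟩ := ht t (Or.inl rfl)
    obtain ⟨z₁, z₂, hne, h1, h2, h3, -, h5, -⟩ := hdeg.exists_two_adj t w w
    refine ⟨t, z₁, z₂, hne, h1, h2, hut, ?_⟩
    have key : ∀ z, T.Adj t z → z ≠ w → ∀ x, T.dist x w + 1 = T.dist x t →
        T.dist x z = T.dist x t + 1 := by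
      intro z hz hzw x hx
      refine (dist_succ_or hT x hz).resolve_left fun h => hzw ?_
      exact adj_dist_succ_unique hT hz.symm hwt h hx.symm
    have hz : ∀ z, T.Adj t z → z ≠ w → T.dist u z = k + 1 + 1 ∧
        ∀ x, x = a ∨ x = b ∨ x = a' ∨ x = b' → T.dist x z = T.dist x u + (k + 1 + 1) := by
      intro z hz hzw
      refine ⟨by rw [key z hz hzw u (by omega), hut], fun x hx => ?_⟩
      have h7 := hxt x hx
      have h8 : T.dist x w ≤ T.dist x u + T.dist u w := hT.connected.dist_triangle
      have h9 := dist_succ_or hT x hwt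
      rw [key z hz hzw x (by omega)]
      omega
    rintro z (rfl | rfl)
    exacts [hz z h1 h3, hz z h2 h5]

end TreeGeometry

/-! ### Balls around vertices and edges -/

section Balls

variable {V : Type*} {T : SimpleGraph V}

/-- The ball `{z | d(a, z) + d(b, z) ≤ n}`. For `a = b` it is the ball of radius `n / 2` around the
vertex `a`; for adjacent `a` and `b` and odd `n` it is the ball of radius `(n - 1) / 2` around the
edge joining them. This treats both kinds of balls at once. -/
def biball (T : SimpleGraph V) (a b : V) (n : ℕ) : Set V := {z | T.dist a z + T.dist b z ≤ n}

theorem mem_biball {a b z : V} {n : ℕ} : z ∈ biball T a b n ↔ T.dist a z + T.dist b z ≤ n := Iff.rfl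

theorem biball_comm (a b : V) (n : ℕ) : biball T a b n = biball T b a n := by
  ext z
  rw [mem_biball, mem_biball, add_comm]

/-- `A` is a member of `𝔗₀` of depth `l`: a ball of radius `(l + 1) / 2` around a vertex if `l` is
odd, a ball of radius `l / 2` around an edge if `l` is even. -/
def IsBallOfDepth (T : SimpleGraph V) (A : Set V) (l : ℕ) : Prop :=
  ∃ a b, T.dist a b ≤ 1 ∧ (l + 1) % 2 = T.dist a b ∧ A = biball T a b (l + 1)

theorem mem_subtreeFamily_iff (hT : T.IsTree) {A : Set V} :
    A ∈ subtreeFamily T ↔ ∃ l, IsBallOfDepth T A l := by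
  have hedge : ∀ {a b : V} (r : ℕ), T.Adj a b →
      edgeBall T s(a, b) r = biball T a b (2 * r + 1) := by
    intro a b r hab
    ext z
    have h := dist_succ_or hT z hab
    rw [SimpleGraph.dist_comm (u := z), SimpleGraph.dist_comm (u := z)] at h
    simp only [edgeBall, mem_biball, Set.mem_ofPred_eq, Sym2.mem_iff, exists_eq_or_imp,
      exists_eq_left]
    omega
  constructor
  · rintro (⟨v, r, hr, rfl⟩ | ⟨e, he, r, rfl⟩)
    · refine ⟨2 * r - 1, v, v, by simp, by rw [SimpleGraph.dist_self]; omega, ?_⟩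
      ext z
      simp only [vertexBall, mem_biball, Set.mem_ofPred_eq]
      omega
    · induction e with
      | _ a b =>
        have hab : T.Adj a b := he
        have h1 := SimpleGraph.dist_eq_one_iff_adj.2 hab
        exact ⟨2 * r, a, b, by omega, by omega, hedge r hab⟩
  · rintro ⟨l, a, b, hab, hl, rfl⟩
    rcases (dist_le_one_iff hT).1 hab with rfl | hadj
    · rw [SimpleGraph.dist_self] at hl
      refine Or.inl ⟨a, (l + 1) / 2, by omega, ?_⟩
      ext z
      simp only [vertexBall, mem_biball, Set.mem_ofPred_eq]
      omega
    · rw [SimpleGraph.dist_eq_one_iff_adj.2 hadj] at hl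
      refine Or.inr ⟨s(a, b), hadj, l / 2, ?_⟩
      rw [hedge _ hadj]
      congr 1
      omega

theorem image_biball (hT : T.IsTree) (g : T ≃g T) (a b : V) (n : ℕ) :
    g '' biball T a b n = biball T (g a) (g b) n := by
  ext z
  obtain ⟨z, rfl⟩ := g.surjective z
  rw [Function.Injective.mem_set_image g.injective, mem_biball, mem_biball, dist_apply hT,
    dist_apply hT]

theorem IsBallOfDepth.image (hT : T.IsTree) {A : Set V} {l : ℕ} (hA : IsBallOfDepth T A l)
    (g : T ≃g T) : IsBallOfDepth T (g '' A) l := by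
  obtain ⟨a, b, hab, hl, rfl⟩ := hA
  exact ⟨g a, g b, by rwa [dist_apply hT], by rwa [dist_apply hT], image_biball hT g a b _⟩

theorem IsBallOfDepth.nonempty {A : Set V} {l : ℕ} (hA : IsBallOfDepth T A l) : A.Nonempty := by
  obtain ⟨a, b, hab, -, rfl⟩ := hA
  refine ⟨a, ?_⟩
  rw [mem_biball, SimpleGraph.dist_self, SimpleGraph.dist_comm]
  omega

/-- A center `{a, b}` on the side of `p` of an edge `pq` is seen from the other side through `q`. -/
theorem dist_eq_of_center_notMem_halfTree (hT : T.IsTree) {p q a b z : V} (hpq : T.Adj p q)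
    (hab : T.dist a b ≤ 1) (ha : a ∉ halfTree T p q) (hz : z ∈ halfTree T p q) :
    T.dist a z = T.dist a q + T.dist q z ∧ T.dist b z = T.dist b q + T.dist q z := by
  have key : ∀ {c}, c ∉ halfTree T p q → T.dist c z = T.dist c q + T.dist q z := by
    intro c hc
    have h1 := dist_eq_of_halfTree hT hpq hz hc
    have h2 := dist_eq_of_notMem_halfTree hT hpq hc
    rw [SimpleGraph.dist_comm, SimpleGraph.dist_comm (u := p)] at h2
    omega
  refine ⟨key ha, ?_⟩
  by_cases hb : b ∈ halfTree T p q
  · rcases (dist_le_one_iff hT).1 hab with rfl | hadj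
    · exact absurd hb ha
    · obtain ⟨rfl, -⟩ := eq_of_adj_of_mem_halfTree hT hpq hb ha hadj.symm
      simp
  · exact key hb

theorem dist_add_dist_le_of_notMem_halfTree (hT : T.IsTree) {p q a : V} (b : V) (hpq : T.Adj p q)
    (ha : a ∉ halfTree T p q) :
    T.dist a p + T.dist b p ≤ T.dist a q + T.dist b q := by
  have h2 := dist_eq_of_notMem_halfTree hT hpq ha
  rw [SimpleGraph.dist_comm, SimpleGraph.dist_comm (u := p)] at h2
  have h3 := dist_succ_or hT b hpq
  omega

theorem notMem_halfTree_or (hT : T.IsTree) {a b : V} (hab : T.Adj a b) (x : V) :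
    x ∉ halfTree T a b ∨ x ∉ halfTree T b a := by
  rw [mem_halfTree_symm_iff hT hab]
  tauto

/-- The quantitative form of an inclusion between two balls. For an edge `pq` whose side of `p`
contains the center `{a', b'}`, the points of `biball T p q n` furthest from that center lie
beyond `q`. -/
theorem exists_of_biball_subset (hT : T.IsTree) (hdeg : HasDegreeGeFour T) {a b a' b' : V}
    {n n' : ℕ} (hn : 1 ≤ n) (hab : T.dist a b ≤ 1) (hpar : n % 2 = T.dist a b)
    (hab' : T.dist a' b' ≤ 1) (hsub : biball T a b n ⊆ biball T a' b' n') :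
    ∃ p q, ((p = a ∧ q = b) ∨ (p = b ∧ q = a)) ∧
      (p = q ∨ (T.Adj p q ∧ a' ∉ halfTree T p q)) ∧
      T.dist a' q + T.dist b' q + n ≤ n' + T.dist p q := by
  rcases (dist_le_one_iff hT).1 hab with rfl | hadj
  · refine ⟨a, a, Or.inl ⟨rfl, rfl⟩, Or.inl rfl, ?_⟩
    rw [SimpleGraph.dist_self] at hpar
    obtain ⟨w, z, _, -, -, -, -, hz⟩ := exists_outward hT hdeg hab hab' a (n / 2 - 1)
    obtain ⟨h1, h2⟩ := hz z (Or.inl rfl)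
    have h3 : z ∈ biball T a a n := by rw [mem_biball]; omega
    have h4 := hsub h3
    rw [mem_biball, h2 a' (by simp), h2 b' (by simp)] at h4
    rw [SimpleGraph.dist_self]
    omega
  · have key : ∀ p q, T.Adj p q → biball T p q n ⊆ biball T a' b' n' → n % 2 = 1 →
        a' ∉ halfTree T p q → T.dist a' q + T.dist b' q + n ≤ n' + T.dist p q := by
      intro p q hpq hsub hpar ha'
      have h0 := SimpleGraph.dist_eq_one_iff_adj.2 hpq
      have h0' := SimpleGraph.dist_eq_one_iff_adj.2 hpq.symm
      by_cases h1 : n = 1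
      · have hq : q ∈ biball T p q n := by rw [mem_biball, SimpleGraph.dist_self]; omega
        have := hsub hq
        rw [mem_biball] at this
        omega
      · obtain ⟨w, z, _, -, -, -, -, hz⟩ := exists_outward hT hdeg h0.le hab' q (n / 2 - 1)
        obtain ⟨h1, h2⟩ := hz z (Or.inl rfl)
        have h3 : z ∈ biball T p q n := by rw [mem_biball, h2 p (by simp)]; omega
        have h4 := hsub h3
        rw [mem_biball, h2 a' (by simp), h2 b' (by simp)] at h4
        omega
    have h1 := SimpleGraph.dist_eq_one_iff_adj.2 hadj
    rcases notMem_halfTree_or hT hadj a' with h | h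
    · exact ⟨a, b, Or.inl ⟨rfl, rfl⟩, Or.inr ⟨hadj, h⟩, key a b hadj hsub (by omega) h⟩
    · exact ⟨b, a, Or.inr ⟨rfl, rfl⟩, Or.inr ⟨hadj.symm, h⟩,
        key b a hadj.symm (by rwa [biball_comm]) (by omega) h⟩

/-- An inclusion of balls increases the depth, strictly unless the balls are equal. -/
theorem IsBallOfDepth.le_of_subset (hT : T.IsTree) (hdeg : HasDegreeGeFour T) {A A' : Set V}
    {l l' : ℕ} (hA : IsBallOfDepth T A l) (hA' : IsBallOfDepth T A' l') (hsub : A ⊆ A') :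
    l ≤ l' ∧ (l = l' → A = A') := by
  obtain ⟨a, b, hab, hl, rfl⟩ := hA
  obtain ⟨a', b', hab', hl', rfl⟩ := hA'
  obtain ⟨p, q, hpq, h1, h2⟩ :=
    exists_of_biball_subset hT hdeg (Nat.le_add_left 1 l) hab hl hab' hsub
  have hball : biball T a b (l + 1) = biball T p q (l + 1) := by
    rcases hpq with ⟨rfl, rfl⟩ | ⟨rfl, rfl⟩
    exacts [rfl, biball_comm _ _ _]
  rcases h1 with rfl | ⟨hadj, ha'⟩
  · rw [SimpleGraph.dist_self] at h2
    refine ⟨by omega, ?_⟩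
    rintro rfl
    have e1 := hT.connected.dist_eq_zero_iff.1 (show T.dist a' p = 0 by omega)
    have e2 := hT.connected.dist_eq_zero_iff.1 (show T.dist b' p = 0 by omega)
    rw [hball, e1, e2]
  · have h3 := dist_eq_of_notMem_halfTree hT hadj ha'
    rw [SimpleGraph.dist_comm, SimpleGraph.dist_comm (u := p)] at h3
    rw [SimpleGraph.dist_eq_one_iff_adj.2 hadj] at h2
    refine ⟨by omega, ?_⟩
    rintro rfl
    have e1 := hT.connected.dist_eq_zero_iff.1 (show T.dist a' p = 0 by omega)
    have e2 := hT.connected.dist_eq_zero_iff.1 (show T.dist b' q = 0 by omega)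
    rw [hball, e1, e2]

/-- A ball of depth `l` contains the center of every ball of depth `l + 1` around it. -/
theorem center_mem_of_subset (hT : T.IsTree) (hdeg : HasDegreeGeFour T) {R : Set V}
    {l : ℕ} {a' b' : V} (hR : IsBallOfDepth T R l) (hab' : T.dist a' b' ≤ 1)
    (hpar : (l + 1 + 1) % 2 = T.dist a' b') (hsub : R ⊆ biball T a' b' (l + 1 + 1)) :
    a' ∈ R ∧ b' ∈ R := by
  obtain ⟨a, b, hab, hl, rfl⟩ := hR
  obtain ⟨p, q, hpq, h1, h2⟩ :=
    exists_of_biball_subset hT hdeg (Nat.le_add_left 1 l) hab hl hab' hsub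
  have hball : biball T a b (l + 1) = biball T p q (l + 1) := by
    rcases hpq with ⟨rfl, rfl⟩ | ⟨rfl, rfl⟩
    exacts [rfl, biball_comm _ _ _]
  have hd : T.dist a b = T.dist p q := by
    rcases hpq with ⟨rfl, rfl⟩ | ⟨rfl, rfl⟩
    exacts [rfl, SimpleGraph.dist_comm]
  rw [hball, mem_biball, mem_biball]
  rw [hd] at hl hab
  rcases h1 with rfl | ⟨hadj, ha'⟩
  · rw [SimpleGraph.dist_self] at h2 hl
    have h3 := SimpleGraph.dist_comm (G := T) (u := a') (v := p)
    have h4 := SimpleGraph.dist_comm (G := T) (u := b') (v := p)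
    omega
  · have h3 := dist_eq_of_notMem_halfTree hT hadj ha'
    rw [SimpleGraph.dist_comm, SimpleGraph.dist_comm (u := p)] at h3
    have h5 := SimpleGraph.dist_eq_one_iff_adj.2 hadj
    have h6 := SimpleGraph.dist_eq_one_iff_adj.2 hadj.symm
    have e0 := hT.connected.dist_eq_zero_iff.1 (show T.dist a' b' = 0 by omega)
    subst e0
    have e1 := hT.connected.dist_eq_zero_iff.1 (show T.dist a' p = 0 by omega)
    subst e1
    rw [SimpleGraph.dist_self]
    omega

/-- For any center `{a, b}` and any vertex `v` there is an edge `pv` such that all the vertices on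
the side of `v` are seen from the center through `v`. -/
theorem exists_adj_dist_eq (hT : T.IsTree) (hdeg : HasDegreeGeFour T) {a b : V}
    (hab : T.dist a b ≤ 1) (v : V) :
    ∃ p, T.Adj p v ∧ ∀ z ∈ halfTree T p v,
      T.dist a z = T.dist a v + T.dist v z ∧ T.dist b z = T.dist b v + T.dist v z := by
  have key : ∀ {a b}, T.dist a b ≤ 1 → a ≠ v → ∃ p, T.Adj p v ∧ ∀ z ∈ halfTree T p v,
      T.dist a z = T.dist a v + T.dist v z ∧ T.dist b z = T.dist b v + T.dist v z := by
    intro a b hab hav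
    obtain ⟨p, hp, hpv⟩ := exists_adj_dist_succ hT hav
    exact ⟨p, hp, fun z hz =>
      dist_eq_of_center_notMem_halfTree hT hp hab (notMem_halfTree_of_dist hpv) hz⟩
  by_cases hav : a = v
  · by_cases hbv : b = v
    · obtain ⟨p, _, -, hp, -⟩ := hdeg.exists_two_adj v v v
      subst hav hbv
      exact ⟨p, hp.symm, by simp⟩
    · obtain ⟨p, hp, h⟩ := key (by rwa [SimpleGraph.dist_comm]) hbv
      exact ⟨p, hp, fun z hz => (h z hz).symm⟩
  · exact key hab hav

/-- The geometric input of the factorization. If `A` is a ball of depth `l + 1` not contained in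
another ball `A'`, then moving the center of `A` half an edge towards that of `A'`, and
decreasing the radius by one half, gives a ball `R` of depth `l` in `A`. Some edge `pq` in `R`
separates `A \ R` from `A' \ R`. -/
theorem IsBallOfDepth.exists_separating (hT : T.IsTree) (hdeg : HasDegreeGeFour T) {A : Set V}
    {l : ℕ} (hA : IsBallOfDepth T A (l + 1)) {a' b' : V} {n' : ℕ} (hab' : T.dist a' b' ≤ 1)
    (hsub : ¬ A ⊆ biball T a' b' n') :
    ∃ R p q, T.Adj p q ∧ IsBallOfDepth T R l ∧ p ∈ R ∧ q ∈ R ∧ R ⊆ A ∧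
      (∀ z ∈ A, z ∉ halfTree T p q → z ∈ R) ∧
      ∀ z ∈ biball T a' b' n', z ∈ halfTree T p q → z ∈ R := by
  have tri : ∀ c q z : V, T.dist c z ≤ T.dist c q + T.dist q z :=
    fun c q z => hT.connected.dist_triangle
  obtain ⟨a, b, hab, hl, rfl⟩ := hA
  rcases (dist_le_one_iff hT).1 hab with rfl | hadj
  · rw [SimpleGraph.dist_self] at hl
    obtain ⟨p, hp, hz'⟩ := exists_adj_dist_eq hT hdeg hab' a
    have h1 := SimpleGraph.dist_eq_one_iff_adj.2 hp
    have h2 := SimpleGraph.dist_eq_one_iff_adj.2 hp.symm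
    refine ⟨biball T p a (l + 1), p, a, hp, ⟨p, a, by omega, by omega, rfl⟩, ?_, ?_, ?_, ?_, ?_⟩
    · rw [mem_biball, SimpleGraph.dist_self]; omega
    · rw [mem_biball, SimpleGraph.dist_self]; omega
    · intro z hz
      rw [mem_biball] at hz ⊢
      have := tri a p z
      omega
    · intro z hz hzh
      have := dist_eq_of_notMem_halfTree hT hp hzh
      rw [mem_biball] at hz ⊢
      omega
    · intro z hz hzh
      by_contra hcon
      refine hsub fun y hy => ?_
      have h3 := dist_eq_of_mem_halfTree hT hp hzh
      have h4 := hz' z hzh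
      rw [mem_biball] at hz hcon hy ⊢
      have h5 := tri a' a y
      have h6 := tri b' a y
      omega
  · have key : ∀ p q, T.Adj p q → l % 2 = 1 →
        ¬ biball T p q (l + 1 + 1) ⊆ biball T a' b' n' → a' ∉ halfTree T p q →
        ∃ R p' q', T.Adj p' q' ∧ IsBallOfDepth T R l ∧ p' ∈ R ∧ q' ∈ R ∧
          R ⊆ biball T p q (l + 1 + 1) ∧
          (∀ z ∈ biball T p q (l + 1 + 1), z ∉ halfTree T p' q' → z ∈ R) ∧
          ∀ z ∈ biball T a' b' n', z ∈ halfTree T p' q' → z ∈ R := by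
      intro p q hpq hl hsub ha'
      have h1 := SimpleGraph.dist_eq_one_iff_adj.2 hpq
      have h2 := SimpleGraph.dist_eq_one_iff_adj.2 hpq.symm
      refine ⟨biball T p p (l + 1), p, q, hpq, ⟨p, p, by simp, by simp; omega, rfl⟩,
        ?_, ?_, ?_, ?_, ?_⟩
      · rw [mem_biball, SimpleGraph.dist_self]; omega
      · rw [mem_biball]; omega
      · intro z hz
        rw [mem_biball] at hz ⊢
        have := tri q p z
        omega
      · intro z hz hzh
        have := dist_eq_of_notMem_halfTree hT hpq hzh
        rw [mem_biball] at hz ⊢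
        omega
      · intro z hz hzh
        by_contra hcon
        refine hsub fun y hy => ?_
        have h3 := dist_eq_of_mem_halfTree hT hpq hzh
        have h4 := dist_eq_of_center_notMem_halfTree hT hpq hab' ha' hzh
        have h7 := dist_add_dist_le_of_notMem_halfTree hT b' hpq ha'
        rw [mem_biball] at hz hcon hy ⊢
        have h5 := tri a' q y
        have h6 := tri b' q y
        have h8 := tri a' p y
        have h9 := tri b' p y
        have h10 := dist_succ_or hT y hpq
        rw [SimpleGraph.dist_comm (u := y), SimpleGraph.dist_comm (u := y)] at h10
        omega
    have h1 := SimpleGraph.dist_eq_one_iff_adj.2 hadj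
    rcases notMem_halfTree_or hT hadj a' with h | h
    · exact key a b hadj (by omega) hsub h
    · rw [biball_comm] at hsub ⊢
      exact key b a hadj.symm (by omega) hsub h

theorem IsBallOfDepth.exists_subset (hT : T.IsTree) (hdeg : HasDegreeGeFour T) {A : Set V}
    {l : ℕ} (hA : IsBallOfDepth T A (l + 1)) : ∃ R ⊆ A, IsBallOfDepth T R l := by
  obtain ⟨c, hc⟩ := hA.nonempty
  have hsub : ¬ A ⊆ biball T c c 0 := by
    intro hsub
    obtain ⟨a, b, hab, hl, rfl⟩ := hA
    obtain ⟨p, q, hpq, h1, h2⟩ :=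
      exists_of_biball_subset hT hdeg (Nat.le_add_left 1 _) hab hl (by simp) hsub
    have hd : T.dist a b = T.dist p q := by
      rcases hpq with ⟨rfl, rfl⟩ | ⟨rfl, rfl⟩
      exacts [rfl, SimpleGraph.dist_comm]
    omega
  obtain ⟨R, -, -, -, hR, -, -, hRA, -⟩ := hA.exists_separating hT hdeg (by simp) hsub
  exact ⟨R, hRA, hR⟩

end Balls

/-! ### Automorphisms of semi-regular trees and their local signs -/

section Automorphisms

variable {V : Type*} {T : SimpleGraph V} {τ : T.Coloring (Fin 2)} {d : Fin 2 → ℕ}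

theorem type_eq_of_adj {u v w x : V} (h : T.Adj u v) (h' : T.Adj w x) (huw : τ u = τ w) :
    τ v = τ x := by
  have h1 := τ.valid h
  have h2 := τ.valid h'
  omega

theorem type_eq_dist (hT : T.IsTree) (τ : T.Coloring (Fin 2)) (u v : V) :
    (τ v : ℕ) = (τ u + T.dist u v) % 2 := by
  obtain ⟨p, hp⟩ := hT.connected.exists_walk_length_eq_dist u v
  rw [← hp]
  clear hp
  induction p with
  | nil => simp; omega
  | cons h p ih =>
    have h1 := τ.valid h
    rw [SimpleGraph.Walk.length_cons]
    omega

theorem type_apply_of_type_apply (hT : T.IsTree) {g : T ≃g T} {c : V} (hc : τ (g c) = τ c) (v : V) :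
    τ (g v) = τ v := by
  have h1 := type_eq_dist hT τ c v
  have h2 := type_eq_dist hT τ (g c) (g v)
  rw [dist_apply hT, hc, ← h1] at h2
  exact Fin.ext h2

/-- The children of `p` in the tree rooted at `w`. -/
def childSet (T : SimpleGraph V) (w p : V) : Set V := {x | T.Adj p x ∧ T.dist w x = T.dist w p + 1}

theorem IsSemiRegularTree.encard_childSet (hT : IsSemiRegularTree T τ d) {w p : V} (hp : p ≠ w) :
    (childSet T w p).encard + 1 = d (τ p) := by
  obtain ⟨q, hq, hd⟩ := exists_adj_dist_succ hT.isTree hp.symm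
  have hins : T.neighborSet p = insert q (childSet T w p) := by
    ext x
    rw [SimpleGraph.mem_neighborSet, Set.mem_insert_iff]
    constructor
    · intro hx
      rcases dist_succ_or hT.isTree w hx with h | h
      · exact Or.inl (adj_dist_succ_unique hT.isTree hx.symm hq h hd)
      · exact Or.inr ⟨hx, h⟩
    · rintro (rfl | h)
      exacts [hq.symm, h.1]
  have hnot : q ∉ childSet T w p := fun h => by
    have := h.2
    omega
  rw [← hT.degree p, hins, Set.encard_insert_of_notMem hnot]

theorem IsSemiRegularTree.exists_bijOn_childSet (hT : IsSemiRegularTree T τ d) {w p q : V}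
    (hp : p ≠ w) (hq : q ≠ w) (hpq : τ p = τ q) :
    ∃ e : V → V, Set.BijOn e (childSet T w p) (childSet T w q) := by
  have h1 := hT.encard_childSet hp
  have h2 := hT.encard_childSet hq
  have hne : (childSet T w p).encard ≠ ⊤ := by
    intro h
    rw [h, top_add] at h1
    exact ENat.natCast_ne_top _ h1.symm
  have hfin : (childSet T w p).Finite := Set.encard_ne_top_iff.1 hne
  have : Nonempty V := ⟨w⟩
  refine hfin.exists_bijOn_of_encard_eq ?_
  rw [hpq, ← h2] at h1
  exact WithTop.add_right_cancel ENat.one_ne_top h1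

/-- Two half-trees hanging from a vertex `w` can be exchanged by an automorphism fixing everything
else. It is built from the root `w` outwards: whenever a vertex `p` is mapped to `q`, the children
of `p` are mapped bijectively to those of `q`, identically if `p = q ≠ w`. -/
theorem IsSemiRegularTree.exists_swap (hT : IsSemiRegularTree T τ d) {w z₁ z₂ : V}
    (h₁ : T.Adj w z₁) (h₂ : T.Adj w z₂) :
    ∃ k : T ≃g T, (∀ x, x ∉ halfTree T w z₁ → x ∉ halfTree T w z₂ → k x = x) ∧
      k z₁ = z₂ ∧ k z₂ = z₁ := by
  classical
  have hTt := hT.isTree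
  have hroot : Set.BijOn (Equiv.swap z₁ z₂) (childSet T w w) (childSet T w w) := by
    have hmem : ∀ x, x ∈ childSet T w w ↔ T.Adj w x := by
      intro x
      refine ⟨fun h => h.1, fun h => ⟨h, ?_⟩⟩
      rw [SimpleGraph.dist_self, SimpleGraph.dist_eq_one_iff_adj.2 h]
    have hmaps : Set.MapsTo (Equiv.swap z₁ z₂) (childSet T w w) (childSet T w w) := by
      intro x hx
      rw [hmem] at hx ⊢
      by_cases hx1 : x = z₁
      · rw [hx1, Equiv.swap_apply_left]; exact h₂
      by_cases hx2 : x = z₂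
      · rw [hx2, Equiv.swap_apply_right]; exact h₁
      rwa [Equiv.swap_apply_of_ne_of_ne hx1 hx2]
    exact ⟨hmaps, (Equiv.injective _).injOn, fun y hy => ⟨_, hmaps hy, Equiv.swap_apply_self _ _ _⟩⟩
  have hex : ∀ p q, ∃ e : V → V, τ p = τ q → (p = w ↔ q = w) →
      Set.BijOn e (childSet T w p) (childSet T w q) ∧ (p = q → p ≠ w → e = id) ∧
        (p = w → e = Equiv.swap z₁ z₂) := by
    intro p q
    by_cases hp : p = w
    · refine ⟨Equiv.swap z₁ z₂, fun _ h => ?_⟩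
      obtain rfl := h.1 hp
      exact ⟨by rwa [hp], fun _ h => absurd hp h, fun _ => rfl⟩
    · by_cases hpq : p = q
      · exact ⟨id, fun _ _ => ⟨hpq ▸ Set.bijOn_id _, fun _ _ => rfl, fun h => absurd h hp⟩⟩
      · by_cases hc : τ p = τ q ∧ q ≠ w
        · obtain ⟨e, he⟩ := hT.exists_bijOn_childSet hp hc.2 hc.1
          exact ⟨e, fun _ _ => ⟨he, fun h => absurd h hpq, fun h => absurd h hp⟩⟩
        · exact ⟨id, fun h h' => absurd ⟨h, fun hq => hp (h'.2 hq)⟩ hc⟩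
  choose e he using hex
  have hparent : ∀ x, ∃ p, x ≠ w → T.Adj p x ∧ T.dist w x = T.dist w p + 1 := by
    intro x
    by_cases hx : x = w
    · exact ⟨w, fun h => absurd hx h⟩
    · obtain ⟨p, hp⟩ := exists_adj_dist_succ hTt (Ne.symm hx)
      exact ⟨p, fun _ => hp⟩
  choose par hpar using hparent
  have hpar_eq : ∀ {p x}, x ∈ childSet T w p → par x = p := by
    intro p x hx
    have hxw : x ≠ w := by
      rintro rfl
      have := hx.2
      rw [SimpleGraph.dist_self] at this
      omega
    exact adj_dist_succ_unique hTt (hpar x hxw).1 hx.1 (hpar x hxw).2 hx.2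
  let Fn : ℕ → V → V := fun n => Nat.rec id (fun _ f x => e (par x) (f (par x)) x) n
  let F : V → V := fun x => Fn (T.dist w x) x
  have hFw : F w = w := by
    change Fn (T.dist w w) w = w
    rw [SimpleGraph.dist_self]
    rfl
  have hFs : ∀ x, x ≠ w → F x = e (par x) (F (par x)) x := by
    intro x hx
    change Fn (T.dist w x) x = e (par x) (Fn (T.dist w (par x)) (par x)) x
    rw [(hpar x hx).2]
  have hdist0 : ∀ {x}, T.dist w x = 0 ↔ x = w := fun {x} => by
    rw [hTt.connected.dist_eq_zero_iff, eq_comm]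
  -- `F` preserves the levels and the types
  have hmain : ∀ n x, T.dist w x = n → T.dist w (F x) = n ∧ τ (F x) = τ x := by
    intro n
    induction n with
    | zero =>
      intro x hx
      obtain rfl := hdist0.1 hx
      rw [hFw]
      exact ⟨hx, rfl⟩
    | succ n ih =>
      intro x hx
      have hxw : x ≠ w := fun h => by rw [h, SimpleGraph.dist_self] at hx; omega
      obtain ⟨hp1, hp2⟩ := hpar x hxw
      obtain ⟨h1, h2⟩ := ih (par x) (by omega)
      have hiff : par x = w ↔ F (par x) = w := by rw [← hdist0, ← hdist0, h1]; omega
      have hm := (he _ _ h2.symm hiff).1.mapsTo (show x ∈ childSet T w (par x) from ⟨hp1, hp2⟩)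
      rw [← hFs x hxw] at hm
      exact ⟨by rw [hm.2, h1], type_eq_of_adj hm.1 hp1 h2⟩
  have hiff : ∀ x, x = w ↔ F x = w := fun x => by
    rw [← hdist0, ← hdist0, (hmain _ x rfl).1]
  have hbij : ∀ p, Set.BijOn (e p (F p)) (childSet T w p) (childSet T w (F p)) := fun p =>
    (he _ _ (hmain _ p rfl).2.symm (hiff p)).1
  have hchild : ∀ {x p}, x ∈ childSet T w p → F x = e p (F p) x := by
    intro x p hx
    have hp := hpar_eq hx
    have hxw : x ≠ w := by
      rintro rfl
      have := hx.2
      rw [SimpleGraph.dist_self] at this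
      omega
    rw [hFs x hxw, hp]
  have hmaps : ∀ {x p}, x ∈ childSet T w p → F x ∈ childSet T w (F p) := fun hx => by
    rw [hchild hx]
    exact (hbij _).mapsTo hx
  have hmem_par : ∀ {x}, x ≠ w → x ∈ childSet T w (par x) := fun hx => hpar _ hx
  have hinj : ∀ n x y, T.dist w x = n → F x = F y → x = y := by
    intro n
    induction n with
    | zero =>
      intro x y hx hxy
      obtain rfl := hdist0.1 hx
      rw [hFw, eq_comm, ← hiff] at hxy
      exact hxy.symm
    | succ n ih =>
      intro x y hx hxy
      have hxw : x ≠ w := fun h => by rw [h, SimpleGraph.dist_self] at hx; omega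
      have hyw : y ≠ w := fun h => hxw ((hiff x).2 (hxy.trans ((hiff y).1 h)))
      have hpx := hpar_eq (hmaps (hmem_par hxw))
      have hpy := hpar_eq (hmaps (hmem_par hyw))
      have hpp : par x = par y := ih _ _ (by have := (hpar x hxw).2; omega) (by
        rw [← hpx, ← hpy, hxy])
      have hy' : y ∈ childSet T w (par x) := hpp ▸ hmem_par hyw
      refine (hbij (par x)).injOn (hmem_par hxw) hy' ?_
      rw [← hchild (hmem_par hxw), ← hchild hy', hxy]
  have hsurj : ∀ n y, T.dist w y = n → ∃ x, F x = y := by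
    intro n
    induction n with
    | zero =>
      intro y hy
      exact ⟨w, by rw [hFw, hdist0.1 hy]⟩
    | succ n ih =>
      intro y hy
      have hyw : y ≠ w := fun h => by rw [h, SimpleGraph.dist_self] at hy; omega
      obtain ⟨p, hp⟩ := ih (par y) (by have := (hpar y hyw).2; omega)
      have hy' : y ∈ childSet T w (F p) := hp ▸ hmem_par hyw
      obtain ⟨x, hx, rfl⟩ := (hbij p).surjOn hy'
      exact ⟨x, hchild hx⟩
  have hFinj : Function.Injective F := fun x y h => hinj _ x y rfl h
  have hFbij : Function.Bijective F := ⟨hFinj, fun y => hsurj _ y rfl⟩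
  have hadj_child : ∀ {x y}, T.Adj x y → x ∈ childSet T w y ∨ y ∈ childSet T w x := by
    intro x y h
    rcases dist_succ_or hTt w h with h' | h'
    exacts [Or.inl ⟨h.symm, h'⟩, Or.inr ⟨h, h'⟩]
  have hadj_of_child : ∀ {x y}, F x ∈ childSet T w (F y) → T.Adj x y := by
    intro x y h
    obtain ⟨x', hx', hxx⟩ := (hbij y).surjOn h
    rw [← hchild hx'] at hxx
    rw [← hFinj hxx]
    exact hx'.1.symm
  have hadj : ∀ {x y}, T.Adj (F x) (F y) ↔ T.Adj x y := by
    intro x y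
    constructor
    · intro h
      rcases hadj_child h with h' | h'
      exacts [hadj_of_child h', (hadj_of_child h').symm]
    · intro h
      rcases hadj_child h with h' | h'
      exacts [(hmaps h').1.symm, (hmaps h').1]
  have hz : ∀ {z}, T.Adj w z → F z = Equiv.swap z₁ z₂ z := by
    intro z hz
    have hc : z ∈ childSet T w w := ⟨hz, by
      rw [SimpleGraph.dist_self, SimpleGraph.dist_eq_one_iff_adj.2 hz]⟩
    rw [hchild hc, (he w (F w) (by rw [hFw]) (by simp [hFw])).2.2 rfl]
  have hfix : ∀ n x, T.dist w x = n → x ∉ halfTree T w z₁ → x ∉ halfTree T w z₂ → F x = x := by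
    intro n
    induction n with
    | zero =>
      intro x hx _ _
      rw [hdist0.1 hx, hFw]
    | succ n ih =>
      intro x hx hx₁ hx₂
      have hxw : x ≠ w := fun h => by rw [h, SimpleGraph.dist_self] at hx; omega
      obtain ⟨hp1, hp2⟩ := hpar x hxw
      have hself : ∀ {z}, T.Adj w z → z ∈ halfTree T w z := fun h => by
        rw [mem_halfTree, SimpleGraph.dist_self, SimpleGraph.dist_eq_one_iff_adj.2 h]
        exact one_pos
      by_cases hpw : par x = w
      · rw [hpw] at hp1
        rw [hz hp1, Equiv.swap_apply_of_ne_of_ne (fun h => hx₁ (by rw [h]; exact hself h₁))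
          (fun h => hx₂ (by rw [h]; exact hself h₂))]
      · have hpn : ∀ {z}, T.Adj w z → x ∉ halfTree T w z → par x ∉ halfTree T w z :=
          fun hz hx hp => hxw (eq_of_adj_of_mem_halfTree hTt hz hp hx hp1).2
        have hFp := ih (par x) (by omega) (hpn h₁ hx₁) (hpn h₂ hx₂)
        rw [hFs x hxw, (he _ _ (by rw [hFp]) (hiff _)).2.1 hFp.symm hpw]
        rfl
  refine ⟨⟨Equiv.ofBijective F hFbij, hadj⟩, fun x hx₁ hx₂ => hfix _ x rfl hx₁ hx₂, ?_, ?_⟩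
  · exact (hz h₁).trans (Equiv.swap_apply_left _ _)
  · exact (hz h₂).trans (Equiv.swap_apply_right _ _)

/-- An automorphism fixing the ends of the edge `pq` can be replaced by the identity on the side of
`p`. -/
theorem exists_glue_id (hT : T.IsTree) {p q : V} (hpq : T.Adj p q) {g : T ≃g T} (hp : g p = p)
    (hq : g q = q) :
    ∃ f : T ≃g T, (∀ x ∈ halfTree T p q, f x = g x) ∧ ∀ x ∉ halfTree T p q, f x = x := by
  classical
  have hmem : ∀ x, g x ∈ halfTree T p q ↔ x ∈ halfTree T p q := by
    intro x
    rw [mem_halfTree, mem_halfTree]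
    nth_rewrite 1 [← hp]
    nth_rewrite 1 [← hq]
    rw [dist_apply hT, dist_apply hT]
  let F : V → V := fun x => if x ∈ halfTree T p q then g x else x
  have h1 : ∀ x ∈ halfTree T p q, F x = g x := fun x hx => if_pos hx
  have h2 : ∀ x ∉ halfTree T p q, F x = x := fun x hx => if_neg hx
  have hF : ∀ x, F x ∈ halfTree T p q ↔ x ∈ halfTree T p q := by
    intro x
    by_cases hx : x ∈ halfTree T p q
    · rw [h1 x hx, hmem]
    · rw [h2 x hx]
  have hbij : Function.Bijective F := by
    refine ⟨fun x y hxy => ?_, fun y => ?_⟩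
    · by_cases hx : x ∈ halfTree T p q
      · have hy := (hF y).1 (hxy ▸ (hF x).2 hx)
        rw [h1 x hx, h1 y hy] at hxy
        exact g.injective hxy
      · have hy : y ∉ halfTree T p q := fun hy => hx ((hF x).1 (hxy ▸ (hF y).2 hy))
        rwa [h2 x hx, h2 y hy] at hxy
    · by_cases hy : y ∈ halfTree T p q
      · obtain ⟨x, rfl⟩ := g.surjective y
        exact ⟨x, h1 x ((hmem x).1 hy)⟩
      · exact ⟨y, h2 y hy⟩
  have hqm : q ∈ halfTree T p q := by
    rw [mem_halfTree, SimpleGraph.dist_self, SimpleGraph.dist_eq_one_iff_adj.2 hpq]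
    exact one_pos
  have hpm : p ∉ halfTree T p q := by
    rw [mem_halfTree, SimpleGraph.dist_self]
    exact Nat.not_lt_zero _
  have hcross : ∀ x y, x ∈ halfTree T p q → y ∉ halfTree T p q →
      (T.Adj (F x) (F y) ↔ T.Adj x y) := by
    intro x y hx hy
    constructor
    · intro h
      obtain ⟨e1, e2⟩ := eq_of_adj_of_mem_halfTree hT hpq ((hF x).2 hx) (mt (hF y).1 hy) h
      rw [h1 x hx, ← hq] at e1
      rw [h2 y hy] at e2
      rw [g.injective e1, e2]
      exact hpq.symm
    · intro h
      obtain ⟨rfl, rfl⟩ := eq_of_adj_of_mem_halfTree hT hpq hx hy h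
      rwa [h1 x hx, h2 y hy, hq]
  have hadj : ∀ {x y}, T.Adj (F x) (F y) ↔ T.Adj x y := by
    intro x y
    by_cases hx : x ∈ halfTree T p q <;> by_cases hy : y ∈ halfTree T p q
    · rw [h1 x hx, h1 y hy, g.map_adj_iff]
    · exact hcross x y hx hy
    · rw [T.adj_comm, T.adj_comm x]
      exact hcross y x hy hx
    · rw [h2 x hx, h2 y hy]
  exact ⟨⟨Equiv.ofBijective F hbij, hadj⟩, h1, h2⟩

namespace LegalColoring

variable (i : LegalColoring T τ d)

theorem coe_localAction (g : T ≃g T) (v : V) (x : Set.Icc 1 (d (τ v))) :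
    (i.localAction g v x : ℕ) = i.color (g ((i.nbrEquiv v).symm x)) := rfl

theorem localSign_congr {g h : T ≃g T} {v : V} (hgh : ∀ x, T.Adj v x → g x = h x) :
    i.localSign g v = i.localSign h v := by
  have : i.localAction g v = i.localAction h v := by
    ext x
    rw [coe_localAction, coe_localAction, hgh _ ((i.nbrEquiv v).symm x).2]
  rw [localSign, this, localSign]

theorem localSign_eq_one {g : T ≃g T} {v : V} (hg : ∀ x, T.Adj v x → g x = x) :
    i.localSign g v = 1 :=
  (i.localSign_congr hg).trans (i.localSign_one v)

theorem localSign_eq_neg_one {k : T ≃g T} {w z₁ z₂ : V} (hne : z₁ ≠ z₂) (h₁ : T.Adj w z₁)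
    (h₂ : T.Adj w z₂) (hk₁ : k z₁ = z₂) (hk₂ : k z₂ = z₁)
    (hk : ∀ x, T.Adj w x → x ≠ z₁ → x ≠ z₂ → k x = x) : i.localSign k w = -1 := by
  have : i.localAction k w =
      Equiv.swap (i.nbrEquiv w ⟨z₁, h₁⟩) (i.nbrEquiv w ⟨z₂, h₂⟩) := by
    ext x
    obtain ⟨⟨y, hy⟩, rfl⟩ := (i.nbrEquiv w).surjective x
    rw [coe_localAction, Equiv.symm_apply_apply]
    change i.color (k y) = _
    by_cases e₁ : y = z₁
    · subst e₁
      rw [hk₁, Equiv.swap_apply_left]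
      rfl
    by_cases e₂ : y = z₂
    · subst e₂
      rw [hk₂, Equiv.swap_apply_right]
      rfl
    rw [hk y hy e₁ e₂, Equiv.swap_apply_of_ne_of_ne]
    · rfl
    · exact fun h => e₁ (congrArg Subtype.val ((i.nbrEquiv w).injective h))
    · exact fun h => e₂ (congrArg Subtype.val ((i.nbrEquiv w).injective h))
  rw [localSign, this, Equiv.Perm.sign_swap]
  exact fun h => hne (congrArg Subtype.val ((i.nbrEquiv w).injective h))

end LegalColoring

end Automorphisms

/-! ### The permutation topology and the parity conditions -/

section Topology

variable {V : Type*} {T : SimpleGraph V} {τ : T.Coloring (Fin 2)} {d : Fin 2 → ℕ}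

theorem nhds_aut_eq (g : T ≃g T) :
    nhds g = ⨅ v, Filter.principal {h : T ≃g T | h v = g v} := by
  let _ : TopologicalSpace V := ⊥
  have _ : DiscreteTopology V := ⟨rfl⟩
  have h1 : nhds g = Filter.comap (fun g : T ≃g T => (g : V → V)) (nhds (g : V → V)) :=
    nhds_induced _ _
  rw [h1, nhds_pi, Filter.pi, Filter.comap_iInf]
  refine iInf_congr fun v => ?_
  rw [nhds_discrete, ← Filter.principal_singleton, Filter.comap_principal, Filter.comap_principal]
  rfl

theorem eventually_apply_eq (g : T ≃g T) (v : V) : ∀ᶠ h in nhds g, h v = g v :=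
  (isOpen_apply_eq v (g v)).mem_nhds rfl

theorem isClopen_apply_mem (v : V) (S : Set V) : IsClopen {g : T ≃g T | g v ∈ S} := by
  have key : ∀ S : Set V, IsOpen {g : T ≃g T | g v ∈ S} := fun S =>
    isOpen_iff_mem_nhds.2 fun g hg => by
      filter_upwards [eventually_apply_eq g v] with h hh
      rw [hh]
      exact hg
  exact ⟨⟨key Sᶜ⟩, key S⟩

/-- In a locally finite tree the automorphisms sending `v` to `w` form a compact set: along an
ultrafilter the images of each vertex are eventually constant, and so are the preimages. -/
theorem isCompact_apply_eq (hT : T.IsTree) (hfin : ∀ v r, (sphere T v r).Finite) (v w : V) :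
    IsCompact {g : T ≃g T | g v = w} := by
  rw [isCompact_iff_ultrafilter_le_nhds']
  intro f hf
  have hφ : ∀ x, ∃ y, {g : T ≃g T | g x = y} ∈ f := by
    intro x
    have h : (⋃ y ∈ sphere T w (T.dist v x), {g : T ≃g T | g x = y}) ∈ f := by
      refine Filter.mem_of_superset hf fun g hg => Set.mem_biUnion (x := g x) ?_ rfl
      have hg' : g v = w := hg
      change T.dist w (g x) = _
      rw [← hg', dist_apply hT]
    obtain ⟨y, -, hy⟩ := (Ultrafilter.finite_biUnion_mem_iff (hfin _ _)).1 h
    exact ⟨y, hy⟩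
  have hψ : ∀ y, ∃ x, {g : T ≃g T | g x = y} ∈ f := by
    intro y
    have h : (⋃ x ∈ sphere T v (T.dist w y), {g : T ≃g T | g x = y}) ∈ f := by
      refine Filter.mem_of_superset hf fun g hg => ?_
      obtain ⟨x, rfl⟩ := g.surjective y
      have hg' : g v = w := hg
      refine Set.mem_biUnion (x := x) ?_ rfl
      change T.dist v x = _
      rw [← hg', dist_apply hT]
    obtain ⟨x, -, hx⟩ := (Ultrafilter.finite_biUnion_mem_iff (hfin _ _)).1 h
    exact ⟨x, hx⟩
  choose φ hφ using hφ
  choose ψ hψ using hψ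
  have hφψ : ∀ y, φ (ψ y) = y := by
    intro y
    obtain ⟨g, h1, h2⟩ := f.nonempty_of_mem (Filter.inter_mem (hφ (ψ y)) (hψ y))
    exact Eq.trans (Eq.symm h1) h2
  have hψφ : ∀ x, ψ (φ x) = x := by
    intro x
    obtain ⟨g, h1, h2⟩ := f.nonempty_of_mem (Filter.inter_mem (hφ x) (hψ (φ x)))
    exact g.injective (Eq.trans h2 (Eq.symm h1))
  have hadj : ∀ {x y}, T.Adj (φ x) (φ y) ↔ T.Adj x y := by
    intro x y
    obtain ⟨g, h1, h2⟩ := f.nonempty_of_mem (Filter.inter_mem (hφ x) (hφ y))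
    have h1' : g x = φ x := h1
    have h2' : g y = φ y := h2
    rw [← h1', ← h2', g.map_adj_iff]
  refine ⟨⟨⟨φ, ψ, hψφ, hφψ⟩, hadj⟩, ?_, ?_⟩
  · obtain ⟨g, h1, h2⟩ := f.nonempty_of_mem (Filter.inter_mem (hφ v) hf)
    exact Eq.trans (Eq.symm h1) h2
  · rw [nhds_aut_eq]
    exact le_iInf fun x => Filter.le_principal_iff.2 (hφ x)

theorem countable_of_finite_sphere (hT : T.IsTree) (hfin : ∀ v r, (sphere T v r).Finite) :
    Countable V := by
  obtain ⟨v⟩ := hT.connected.nonempty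
  refine Set.countable_univ_iff.1 ((Set.countable_iUnion fun r => (hfin v r).countable).mono ?_)
  exact fun x _ => Set.mem_iUnion.2 ⟨T.dist v x, rfl⟩

theorem secondCountableTopology_aut [Countable V] : SecondCountableTopology (T ≃g T) := by
  let _ : TopologicalSpace V := ⊥
  have _ : DiscreteTopology V := ⟨rfl⟩
  exact (Topology.IsInducing.mk rfl : Topology.IsInducing
    (fun g : T ≃g T => (g : V → V))).secondCountableTopology

theorem totallySeparatedSpace_aut : TotallySeparatedSpace (T ≃g T) := by
  rw [totallySeparatedSpace_iff_exists_isClopen]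
  intro g h hgh
  obtain ⟨v, hv⟩ : ∃ v, g v ≠ h v := by
    by_contra! hcon
    exact hgh (RelIso.ext hcon)
  exact ⟨_, isClopen_apply_mem v {g v}, rfl, fun h' => hv (Eq.symm h')⟩

namespace LegalColoring

variable (i : LegalColoring T τ d)

theorem finite_neighborSet (i : LegalColoring T τ d) (v : V) : (T.neighborSet v).Finite :=
  (i.bijOn v).finite_iff_finite.2 (Set.finite_Icc _ _)

theorem sgn_congr {g h : T ≃g T} {B : Set V} (hgh : ∀ w ∈ B, ∀ x, T.Adj w x → g x = h x) :
    i.sgn g B = i.sgn h B :=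
  finprod_mem_congr rfl fun w hw => i.localSign_congr (hgh w hw)

theorem isClosed_sgn_eq_one {B : Set V} (hB : B.Finite) : IsClosed {g | i.sgn g B = 1} := by
  rw [← isOpen_compl_iff, isOpen_iff_mem_nhds]
  intro g hg
  have h : ∀ᶠ h in nhds g, ∀ w ∈ B, ∀ x ∈ T.neighborSet w, h x = g x :=
    (Filter.eventually_all_finite hB).2 fun w _ =>
      (Filter.eventually_all_finite (i.finite_neighborSet w)).2 fun x _ => eventually_apply_eq g x
  filter_upwards [h] with h hh hcon
  exact hg ((i.sgn_congr hh).symm.trans hcon)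

end LegalColoring

/-- The parity condition at the vertex `u` in the definition of `G⁺_(i)(Y 0, Y 1)` that concerns the
set `Y j`. It is void unless the outermost sphere in `S_{Y j}(u)` consists of vertices of type
`j`. -/
def parityCondition (i : LegalColoring T τ d) (Y : Fin 2 → Finset ℕ) (j : Fin 2) (u : V) :
    Set (T ≃g T) :=
  {g | (τ u : ℕ) = (j + (Y j).sup id) % 2 → i.sgn g (sphereUnion T (Y j) u) = 1}

theorem mem_raduGroup_iff (hT : T.IsTree) (i : LegalColoring T τ d) {Y₀ Y₁ : Finset ℕ}
    {g : T ≃g T} :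
    g ∈ raduGroup hT i Y₀ Y₁ ↔ (∀ v, τ (g v) = τ v) ∧
      ∀ j u, g ∈ parityCondition i ![Y₀, Y₁] j u := by
  rw [Fin.forall_fin_two]
  simp only [parityCondition, Matrix.cons_val_zero, Matrix.cons_val_one, Fin.val_zero, Fin.val_one,
    zero_add]
  rfl

theorem isClosed_parityCondition (hT : T.IsTree) (i : LegalColoring T τ d) (Y : Fin 2 → Finset ℕ)
    (j : Fin 2) (u : V) : IsClosed (parityCondition i Y j u) := by
  by_cases h : (τ u : ℕ) = (j + (Y j).sup id) % 2
  · simpa [parityCondition, h] using i.isClosed_sgn_eq_one (i.finite_sphereUnion hT (Y j) u)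
  · simp [parityCondition, h]

theorem isClosed_raduGroup (hT : T.IsTree) (i : LegalColoring T τ d) (Y₀ Y₁ : Finset ℕ) :
    IsClosed (raduGroup hT i Y₀ Y₁ : Set (T ≃g T)) := by
  have : (raduGroup hT i Y₀ Y₁ : Set (T ≃g T)) = (⋂ v, {g | g v ∈ {w | τ w = τ v}}) ∩
      ⋂ j, ⋂ u, parityCondition i ![Y₀, Y₁] j u := by
    ext g
    rw [SetLike.mem_coe, mem_raduGroup_iff]
    simp
  rw [this]
  exact (isClosed_iInter fun v => (isClopen_apply_mem v _).1).inter
    (isClosed_iInter fun j => isClosed_iInter fun u => isClosed_parityCondition hT i _ j u)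

end Topology

/-! ### Extending partial automorphisms to elements of the group -/

section Extension

variable {V : Type*} {T : SimpleGraph V} {τ : T.Coloring (Fin 2)} {d : Fin 2 → ℕ}

theorem eq_of_dist_add_eq (hT : T.IsTree) {c u u' w : V}
    (hu : T.dist c w = T.dist c u + T.dist u w) (hu' : T.dist c w = T.dist c u' + T.dist u' w)
    (h : T.dist u w = T.dist u' w) : u = u' := by
  have key : ∀ m w, T.dist c w = T.dist c u + T.dist u w → T.dist c w = T.dist c u' + T.dist u' w →
      T.dist u w = m → T.dist u' w = m → u = u' := by
    intro m
    induction m with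
    | zero =>
      intro w _ _ h1 h2
      rw [hT.connected.dist_eq_zero_iff] at h1 h2
      rw [h1, h2]
    | succ m ih =>
      intro w hu hu' h1 h2
      have hne : ∀ {x}, T.dist x w = m + 1 → x ≠ w := by
        rintro x hx rfl
        rw [SimpleGraph.dist_self] at hx
        omega
      obtain ⟨p, hp, hpd⟩ := exists_adj_dist_succ hT (hne h1)
      obtain ⟨p', hp', hpd'⟩ := exists_adj_dist_succ hT (hne h2)
      have t1 : T.dist c p ≤ T.dist c u + T.dist u p := hT.connected.dist_triangle
      have t2 : T.dist c p' ≤ T.dist c u' + T.dist u' p' := hT.connected.dist_triangle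
      have e1 := dist_succ_or hT c hp
      have e2 := dist_succ_or hT c hp'
      obtain rfl : p = p' := adj_dist_succ_unique hT hp hp' (u := c) (by omega) (by omega)
      exact ih p (by omega) (by omega) (by omega) (by omega)
  exact key _ w hu hu' rfl h.symm

theorem dist_le_sup_of_mem_sphereUnion {Y : Finset ℕ} {u w : V} (hw : w ∈ sphereUnion T Y u) :
    T.dist u w ≤ Y.sup id := by
  obtain ⟨r, hr, h⟩ := Set.mem_iUnion₂.1 hw
  have h' : T.dist u w = r := h
  exact h' ▸ Finset.le_sup (f := id) hr

theorem mem_sphereUnion_iff {Y : Finset ℕ} {u w : V} :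
    w ∈ sphereUnion T Y u ↔ T.dist u w ∈ Y := by
  simp [sphereUnion, sphere]

/-- Extension of a partial automorphism to an element of the group. Let `f` be an automorphism and
let `D` be a set of vertices containing `c`. Suppose that each parity condition either only concerns
the values on `D`, and holds for `f`, or can be repaired at a furthest vertex `w` away from `c`,
because two half-trees hanging from `w` avoid `D`. Then some element of the group agrees with
`f` on `D`.

By compactness only finitely many conditions have to be dealt with. They are repaired in the order
of the distance of `w` from `c`: an exchange of two half-trees at `w` has sign `-1` at `w` and
moves nothing nearer to `c`, so it affects none of the conditions treated before. -/
theorem exists_mem_raduGroup_eqOn (hT : IsSemiRegularTree T τ d) (i : LegalColoring T τ d)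
    (Y₀ Y₁ : Finset ℕ) {f : T ≃g T} (hf : ∀ v, τ (f v) = τ v) {c : V} {D : Set V} (hc : c ∈ D)
    (hD : ∀ j u, (∀ w ∈ sphereUnion T (![Y₀, Y₁] j) u, ∀ x, T.Adj w x → x ∈ D) ∧
        f ∈ parityCondition i ![Y₀, Y₁] j u ∨
      ∃ w z₁ z₂, z₁ ≠ z₂ ∧ T.Adj w z₁ ∧ T.Adj w z₂ ∧ T.dist u w = (![Y₀, Y₁] j).sup id ∧
        ∀ z, z = z₁ ∨ z = z₂ → T.dist c z = T.dist c u + ((![Y₀, Y₁] j).sup id + 1) ∧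
          ∀ x ∈ D, x ∉ halfTree T w z) :
    ∃ h ∈ raduGroup hT.isTree i Y₀ Y₁, ∀ x ∈ D, h x = f x := by
  set Y : Fin 2 → Finset ℕ := ![Y₀, Y₁] with hY
  have hTt := hT.isTree
  have hcomp : IsCompact {h : T ≃g T | ∀ x ∈ D, h x = f x} := by
    have hcl : IsClosed {h : T ≃g T | ∀ x ∈ D, h x = f x} := by
      have : {h : T ≃g T | ∀ x ∈ D, h x = f x} = ⋂ x ∈ D, {h | h x ∈ ({f x} : Set V)} := by
        ext h
        simp
      rw [this]
      exact isClosed_biInter fun x _ => (isClopen_apply_mem x _).1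
    exact (isCompact_apply_eq hTt (i.finite_sphere hTt) c (f c)).of_isClosed_subset hcl
      fun h hh => hh c hc
  let level : Fin 2 × V → ℕ := fun a => T.dist c a.2 + (Y a.1).sup id
  have hfinite : ∀ F : Finset (Fin 2 × V), ∃ h : T ≃g T, (∀ x ∈ D, h x = f x) ∧
      ∀ a ∈ F, h ∈ parityCondition i Y a.1 a.2 := by
    intro F
    classical
    induction F using Finset.induction_on_max_value level with
    | empty => exact ⟨f, fun _ _ => rfl, by simp⟩
    | insert a s has hmax ih =>
      obtain ⟨h, hhD, hhs⟩ := ih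
      obtain ⟨j, u⟩ := a
      by_cases hgood : h ∈ parityCondition i Y j u
      · refine ⟨h, hhD, fun b hb => ?_⟩
        rcases Finset.mem_insert.1 hb with rfl | hb
        exacts [hgood, hhs b hb]
      have hgood' : (τ u : ℕ) = (j + (Y j).sup id) % 2 ∧ i.sgn h (sphereUnion T (Y j) u) ≠ 1 := by
        simpa [parityCondition] using hgood
      obtain ⟨htype, hsgn⟩ := hgood'
      rcases hD j u with ⟨hin, hfu⟩ | ⟨w, z₁, z₂, hne, h₁, h₂, huw, hz⟩
      · refine absurd ?_ hsgn
        rw [← hfu htype]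
        exact i.sgn_congr fun w hw x hx => hhD x (hin w hw x hx)
      have hYj : (Y j).Nonempty := by
        by_contra hcon
        rw [Finset.not_nonempty_iff_eq_empty] at hcon
        exact hsgn (by simp [hcon, sphereUnion, LegalColoring.sgn])
      have hwS : w ∈ sphereUnion T (Y j) u := by
        rw [mem_sphereUnion_iff, huw]
        have := Finset.exists_mem_eq_sup (Y j) hYj id
        obtain ⟨r, hr, hr'⟩ := this
        rw [hr']
        exact hr
      have hcw : T.dist c w = T.dist c u + (Y j).sup id := by
        have t1 : T.dist c w ≤ T.dist c u + T.dist u w := hTt.connected.dist_triangle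
        have t2 := (hz z₁ (Or.inl rfl)).1
        have t3 := dist_succ_or hTt c h₁
        omega
      have hfar : ∀ z, z = z₁ ∨ z = z₂ → ∀ x ∈ halfTree T w z,
          T.dist c x = T.dist c w + 1 + T.dist z x := by
        intro z hz' x hx
        have hwz : T.Adj w z := by
          rcases hz' with rfl | rfl
          exacts [h₁, h₂]
        exact dist_eq_of_halfTree hTt hwz hx ((hz z hz').2 c hc)
      obtain ⟨k, hk, hk₁, hk₂⟩ := hT.exists_swap h₁ h₂
      have hknear : ∀ x, T.dist c x ≤ T.dist c w → k x = x := by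
        intro x hx
        refine hk x (fun h' => ?_) (fun h' => ?_)
        · have := hfar z₁ (Or.inl rfl) x h'
          omega
        · have := hfar z₂ (Or.inr rfl) x h'
          omega
      have hkw : i.localSign k w = -1 := by
        refine i.localSign_eq_neg_one hne h₁ h₂ hk₁ hk₂ fun x hx hx₁ hx₂ => ?_
        have hnot : ∀ z, T.Adj w z → x ≠ z → x ∉ halfTree T w z := by
          intro z hz hxz hxh
          refine hxz (eq_of_adj_of_mem_halfTree hTt hz hxh ?_ hx.symm).1
          rw [mem_halfTree, SimpleGraph.dist_self]
          exact Nat.not_lt_zero _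
        exact hk x (hnot z₁ h₁ hx₁) (hnot z₂ h₂ hx₂)
      have hklocal : ∀ x, T.dist c x ≤ T.dist c w → x ≠ w → i.localSign k x = 1 := by
        intro x hx hxw
        refine i.localSign_eq_one fun y hxy => ?_
        have hnot : ∀ z, z = z₁ ∨ z = z₂ → T.Adj w z → y ∉ halfTree T w z := by
          intro z hz hwz hyh
          refine hxw (eq_of_adj_of_mem_halfTree hTt hwz hyh (fun hxh => ?_) hxy.symm).2
          have := hfar z hz x hxh
          omega
        exact hk y (hnot z₁ (Or.inl rfl) h₁) (hnot z₂ (Or.inr rfl) h₂)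
      have hlevel : ∀ j' u', T.dist c u' + (Y j').sup id ≤ T.dist c w →
          ∀ x ∈ sphereUnion T (Y j') u', T.dist c x ≤ T.dist c w := by
        intro j' u' hl x hx
        have t1 : T.dist c x ≤ T.dist c u' + T.dist u' x := hTt.connected.dist_triangle
        have t2 := dist_le_sup_of_mem_sphereUnion hx
        omega
      refine ⟨h * k, fun x hx => ?_, fun b hb => ?_⟩
      · change h (k x) = f x
        rw [hk x ((hz z₁ (Or.inl rfl)).2 x hx) ((hz z₂ (Or.inr rfl)).2 x hx), hhD x hx]
      rcases Finset.mem_insert.1 hb with rfl | hbs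
      · intro _
        change i.sgn (h * k) (sphereUnion T (Y j) u) = 1
        have hku : k u = u := hknear u (by omega)
        have hkS : i.sgn k (sphereUnion T (Y j) u) = -1 := by
          rw [LegalColoring.sgn, finprod_eq_single _ w]
          · simp [hwS, hkw]
          · intro x hx
            by_cases hxS : x ∈ sphereUnion T (Y j) u
            · simp [hklocal x (hlevel j u hcw.ge x hxS) hx]
            · simp [hxS]
        rw [i.sgn_mul hTt, hku, hkS, (Int.units_eq_one_or _).resolve_left hsgn]
        decide
      · obtain ⟨j', u'⟩ := b
        have hl : T.dist c u' + (Y j').sup id ≤ T.dist c w := by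
          have := hmax _ hbs
          simp only [level] at this
          omega
        intro htype'
        change i.sgn (h * k) (sphereUnion T (Y j') u') = 1
        have hku : k u' = u' := hknear u' (by omega)
        rw [i.sgn_mul hTt, hku, hhs _ hbs htype', one_mul]
        refine finprod_mem_eq_one_of_forall_eq_one fun x hx => hklocal x (hlevel j' u' hl x hx) ?_
        -- the vertex `w` determines the condition that it is used to repair
        rintro rfl
        have t1 := dist_le_sup_of_mem_sphereUnion hx
        have t2 : T.dist c x ≤ T.dist c u' + T.dist u' x := hTt.connected.dist_triangle
        have t3 := type_eq_dist hTt τ u x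
        have t4 := type_eq_dist hTt τ u' x
        have htype'' : (τ u' : ℕ) = (j' + (Y j').sup id) % 2 := htype'
        have hjj : j' = j := by
          have : T.dist u' x = (Y j').sup id := by omega
          ext
          omega
        subst hjj
        have huu : u' = u :=
          eq_of_dist_add_eq hTt (c := c) (w := x) (by omega) (by omega) (by omega)
        subst huu
        exact has hbs
  obtain ⟨h, hhD, hh⟩ := hcomp.inter_iInter_nonempty
    (fun a : Fin 2 × V => parityCondition i Y a.1 a.2)
    (fun a => isClosed_parityCondition hTt i Y a.1 a.2) (fun F => by
      obtain ⟨h, h1, h2⟩ := hfinite F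
      exact ⟨h, h1, Set.mem_iInter₂.2 h2⟩)
  refine ⟨h, (mem_raduGroup_iff hTt i).2 ⟨?_, fun j u => Set.mem_iInter.1 hh (j, u)⟩, hhD⟩
  exact type_apply_of_type_apply hTt (c := c) (by rw [hhD c hc, hf])

/-- An automorphism `f` agrees on the union of two balls with an element of the group as soon as it
satisfies the parity conditions contained in one of the balls. A condition contained in neither can
be repaired away from both centers. -/
theorem exists_mem_raduGroup_eqOn_biball (hT : IsSemiRegularTree T τ d) (hdeg : HasDegreeGeFour T)
    (i : LegalColoring T τ d) (Y₀ Y₁ : Finset ℕ) {f : T ≃g T} (hf : ∀ v, τ (f v) = τ v)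
    {a b a' b' : V} {n n' : ℕ} (hab : T.dist a b ≤ 1) (hab' : T.dist a' b' ≤ 1)
    (ha : a ∈ biball T a b n)
    (h : ∀ j u, (∀ x, T.dist u x ≤ (![Y₀, Y₁] j).sup id + 1 → x ∈ biball T a b n) →
      f ∈ parityCondition i ![Y₀, Y₁] j u)
    (h' : ∀ j u, (∀ x, T.dist u x ≤ (![Y₀, Y₁] j).sup id + 1 → x ∈ biball T a' b' n') →
      f ∈ parityCondition i ![Y₀, Y₁] j u) :
    ∃ g ∈ raduGroup hT.isTree i Y₀ Y₁, ∀ x, x ∈ biball T a b n ∨ x ∈ biball T a' b' n' →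
      g x = f x := by
  have hTt := hT.isTree
  have tri : ∀ c q z : V, T.dist c z ≤ T.dist c q + T.dist q z :=
    fun c q z => hTt.connected.dist_triangle
  refine exists_mem_raduGroup_eqOn hT i Y₀ Y₁ hf (c := a) (D := biball T a b n ∪ biball T a' b' n')
    (Or.inl ha) fun j u => ?_
  have hnear : ∀ w ∈ sphereUnion T (![Y₀, Y₁] j) u, ∀ x, T.Adj w x →
      T.dist u x ≤ (![Y₀, Y₁] j).sup id + 1 := by
    intro w hw x hx
    have h1 := dist_le_sup_of_mem_sphereUnion hw
    have h2 := tri u w x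
    rw [SimpleGraph.dist_eq_one_iff_adj.2 hx] at h2
    omega
  by_cases hA : ∀ x, T.dist u x ≤ (![Y₀, Y₁] j).sup id + 1 → x ∈ biball T a b n
  · exact Or.inl ⟨fun w hw x hx => Or.inl (hA x (hnear w hw x hx)), h j u hA⟩
  by_cases hA' : ∀ x, T.dist u x ≤ (![Y₀, Y₁] j).sup id + 1 → x ∈ biball T a' b' n'
  · exact Or.inl ⟨fun w hw x hx => Or.inr (hA' x (hnear w hw x hx)), h' j u hA'⟩
  right
  obtain ⟨w, z₁, z₂, hne, h₁, h₂, huw, hz⟩ :=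
    exists_outward hTt hdeg hab hab' u ((![Y₀, Y₁] j).sup id)
  refine ⟨w, z₁, z₂, hne, h₁, h₂, huw, fun z hz' => ⟨(hz z hz').2 a (by simp), ?_⟩⟩
  have hwz : T.Adj w z := by
    rcases hz' with rfl | rfl
    exacts [h₁, h₂]
  have key : ∀ {p q m}, p = a ∨ p = b ∨ p = a' ∨ p = b' → q = a ∨ q = b ∨ q = a' ∨ q = b' →
      (¬ ∀ x, T.dist u x ≤ (![Y₀, Y₁] j).sup id + 1 → x ∈ biball T p q m) →
      ∀ x ∈ biball T p q m, x ∉ halfTree T w z := by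
    intro p q m hp hq hnot x hx hxh
    push Not at hnot
    obtain ⟨y, hy, hym⟩ := hnot
    have hpz := (hz z hz').2 p hp
    have hqz := (hz z hz').2 q hq
    have t1 := tri p u y
    have t2 := tri q u y
    have t3 := tri p u w
    have t4 := tri q u w
    have t5 := dist_succ_or hTt p hwz
    have t6 := dist_succ_or hTt q hwz
    have hpx := dist_eq_of_halfTree hTt hwz hxh (y := p) (notMem_halfTree_of_dist (by omega))
    have hqx := dist_eq_of_halfTree hTt hwz hxh (y := q) (notMem_halfTree_of_dist (by omega))
    rw [mem_biball] at hx hym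
    omega
  rintro x (hx | hx)
  · exact key (by simp) (by simp) hA x hx
  · exact key (by simp) (by simp) hA' x hx

end Extension

/-! ### Elements with prescribed action on balls -/

section Consequences

variable {V : Type*} {T : SimpleGraph V} {τ : T.Coloring (Fin 2)} {d : Fin 2 → ℕ}

theorem IsSemiRegularTree.hasDegreeGeFour (hT : IsSemiRegularTree T τ d) (hd : ∀ t, 4 ≤ d t) :
    HasDegreeGeFour T := by
  intro v
  rw [hT.degree]
  exact_mod_cast hd (τ v)

theorem parityCondition_of_eqOn {i : LegalColoring T τ d} {Y : Fin 2 → Finset ℕ} {j : Fin 2}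
    {u : V} {A : Set V} {f g : T ≃g T} (hT : T.IsTree)
    (hA : ∀ x, T.dist u x ≤ (Y j).sup id + 1 → x ∈ A) (hfg : ∀ x ∈ A, f x = g x)
    (hg : g ∈ parityCondition i Y j u) : f ∈ parityCondition i Y j u := by
  intro htype
  rw [← hg htype]
  refine i.sgn_congr fun w hw x hx => hfg x (hA x ?_)
  have h1 := dist_le_sup_of_mem_sphereUnion hw
  have h2 : T.dist u x ≤ T.dist u w + T.dist w x := hT.connected.dist_triangle
  rw [SimpleGraph.dist_eq_one_iff_adj.2 hx] at h2
  omega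

theorem mem_biball_self_zero (hT : T.IsTree) {x y : V} : x ∈ biball T y y 0 ↔ x = y := by
  rw [mem_biball]
  constructor
  · intro h
    exact (hT.connected.dist_eq_zero_iff.1 (show T.dist y x = 0 by omega)).symm
  · rintro rfl
    simp

theorem not_forall_mem_biball_self_zero (hT : T.IsTree) (hdeg : HasDegreeGeFour T) (u y : V)
    (m : ℕ) : ¬ ∀ x, T.dist u x ≤ m + 1 → x ∈ biball T y y 0 := by
  intro h
  obtain ⟨z₁, z₂, hne, h₁, h₂, -⟩ := hdeg.exists_two_adj u u u
  have key : ∀ z, T.Adj u z → z = y := fun z hz => (mem_biball_self_zero hT).1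
    (h z (by rw [SimpleGraph.dist_eq_one_iff_adj.2 hz]; omega))
  exact hne ((key z₁ h₁).trans (key z₂ h₂).symm)

/-- The group contains elements fixing a ball pointwise and moving a given vertex outside it. -/
theorem exists_fixing_biball_ne (hT : IsSemiRegularTree T τ d) (hdeg : HasDegreeGeFour T)
    (i : LegalColoring T τ d) (Y₀ Y₁ : Finset ℕ) {a b y : V} {n : ℕ} (hab : T.dist a b ≤ 1)
    (hn : T.dist a b ≤ n) (hy : y ∉ biball T a b n) :
    ∃ g ∈ raduGroup hT.isTree i Y₀ Y₁, (∀ x ∈ biball T a b n, g x = x) ∧ g y ≠ y := by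
  have hTt := hT.isTree
  have ha : a ∈ biball T a b n := by
    rwa [mem_biball, SimpleGraph.dist_self, SimpleGraph.dist_comm, zero_add]
  have hb : b ∈ biball T a b n := by rwa [mem_biball, SimpleGraph.dist_self, add_zero]
  obtain ⟨p, hp, hpa⟩ := exists_adj_dist_succ hTt (show a ≠ y from fun h => hy (h ▸ ha))
  have hpb : T.dist b y = T.dist b p + 1 := by
    refine (dist_succ_or hTt b hp).resolve_left fun h => ?_
    have hbm : b ∈ halfTree T p y := by
      rw [mem_halfTree, SimpleGraph.dist_comm, SimpleGraph.dist_comm (u := p)]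
      omega
    have ham := notMem_halfTree_of_dist hpa
    rcases (dist_le_one_iff hTt).1 hab with rfl | hadj
    · exact ham hbm
    · exact hy ((eq_of_adj_of_mem_halfTree hTt hp hbm ham hadj.symm).1 ▸ hb)
  obtain ⟨z, hz, hzy, hza, hzb⟩ : ∃ z, T.Adj p z ∧ z ≠ y ∧ T.dist a z = T.dist a p + 1 ∧
      T.dist b z = T.dist b p + 1 := by
    obtain ⟨w, z₁, z₂, hne, h₁, h₂, hw, hz⟩ := exists_outward hTt hdeg hab hab p 0
    obtain rfl := hTt.connected.dist_eq_zero_iff.1 hw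
    by_cases h : z₁ = y
    · exact ⟨z₂, h₂, fun h' => hne (h.trans h'.symm), (hz z₂ (by simp)).2 a (by simp),
        (hz z₂ (by simp)).2 b (by simp)⟩
    · exact ⟨z₁, h₁, h, (hz z₁ (by simp)).2 a (by simp), (hz z₁ (by simp)).2 b (by simp)⟩
  obtain ⟨k, hk, hk₁, hk₂⟩ := hT.exists_swap hp hz
  have hkA : ∀ x ∈ biball T a b n, k x = x := by
    have key : ∀ t, T.Adj p t → T.dist a t = T.dist a p + 1 → T.dist b t = T.dist b p + 1 →
        ∀ x ∈ biball T a b n, x ∉ halfTree T p t := by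
      intro t ht hta htb x hx hxh
      have h1 := dist_eq_of_halfTree hTt ht hxh (notMem_halfTree_of_dist hta)
      have h2 := dist_eq_of_halfTree hTt ht hxh (notMem_halfTree_of_dist htb)
      rw [mem_biball] at hx hy
      omega
    exact fun x hx => hk x (key y hp hpa hpb x hx) (key z hz hza hzb x hx)
  have hktype : ∀ v, τ (k v) = τ v := type_apply_of_type_apply hTt (c := a) (by rw [hkA a ha])
  obtain ⟨g, hg, hgk⟩ := exists_mem_raduGroup_eqOn_biball hT hdeg i Y₀ Y₁ hktype hab
    (show T.dist y y ≤ 1 by simp) (n' := 0) ha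
    (fun j u hA => parityCondition_of_eqOn hTt hA (g := 1) hkA fun _ => i.sgn_one _)
    (fun j u hA => absurd hA (not_forall_mem_biball_self_zero hTt hdeg u y _))
  refine ⟨g, hg, fun x hx => (hgk x (Or.inl hx)).trans (hkA x hx), ?_⟩
  rw [hgk y (Or.inr ((mem_biball_self_zero hTt).2 rfl)), hk₁]
  exact hzy

/-- The stabilizer of a vertex in the group is transitive on its neighbours. -/
theorem exists_apply_eq_of_adj (hT : IsSemiRegularTree T τ d) (hdeg : HasDegreeGeFour T)
    (i : LegalColoring T τ d) (Y₀ Y₁ : Finset ℕ) {u v w : V} (hv : T.Adj u v) (hw : T.Adj u w) :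
    ∃ g ∈ raduGroup hT.isTree i Y₀ Y₁, g u = u ∧ g v = w := by
  have hTt := hT.isTree
  obtain ⟨k, hk, hk₁, -⟩ := hT.exists_swap hv hw
  have hu : ∀ z, u ∉ halfTree T u z := by
    intro z hz
    rw [mem_halfTree, SimpleGraph.dist_self] at hz
    omega
  have hku := hk u (hu v) (hu w)
  have hktype : ∀ v, τ (k v) = τ v := type_apply_of_type_apply hTt (c := u) (by rw [hku])
  obtain ⟨g, hg, hgk⟩ := exists_mem_raduGroup_eqOn_biball hT hdeg i Y₀ Y₁ hktype
    (show T.dist u u ≤ 1 by simp) (show T.dist v v ≤ 1 by simp) (n := 0) (n' := 0)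
    ((mem_biball_self_zero hTt).2 rfl)
    (fun j x hA => absurd hA (not_forall_mem_biball_self_zero hTt hdeg x _ _))
    (fun j x hA => absurd hA (not_forall_mem_biball_self_zero hTt hdeg x _ _))
  refine ⟨g, hg, ?_, ?_⟩
  · rw [hgk u (Or.inl ((mem_biball_self_zero hTt).2 rfl)), hku]
  · rw [hgk v (Or.inr ((mem_biball_self_zero hTt).2 rfl)), hk₁]

/-- The factorization of pointwise fixators. An element fixing `R` is first replaced by the identity
on the side of an edge of `R` that contains `A' \ R`; the result agrees with it on `A` and is
trivial on `A'`, and can therefore be corrected outside `A ∪ A'` to an element of the group. -/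
theorem exists_factorization (hT : IsSemiRegularTree T τ d) (hdeg : HasDegreeGeFour T)
    (i : LegalColoring T τ d) (Y₀ Y₁ : Finset ℕ) {A A' : Set V} {l l' : ℕ}
    (hA : IsBallOfDepth T A (l + 1)) (hA' : IsBallOfDepth T A' l') (hsub : ¬ A ⊆ A') :
    ∃ R, IsBallOfDepth T R l ∧ R ⊆ A ∧
      ∀ g ∈ raduGroup hT.isTree i Y₀ Y₁, (∀ x ∈ R, g x = x) →
        ∃ h ∈ raduGroup hT.isTree i Y₀ Y₁, (∀ x ∈ A', h x = x) ∧ ∀ x ∈ A, h x = g x := by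
  have hTt := hT.isTree
  obtain ⟨a', b', hab', -, rfl⟩ := hA'
  obtain ⟨R, p, q, hpq, hR, hpR, hqR, hRA, hAR, hAR'⟩ := hA.exists_separating hTt hdeg hab' hsub
  obtain ⟨c, hc⟩ := hR.nonempty
  obtain ⟨a, b, hab, hl, rfl⟩ := hA
  refine ⟨R, hR, hRA, fun g hg hgR => ?_⟩
  obtain ⟨f, hf₁, hf₂⟩ := exists_glue_id hTt hpq (hgR p hpR) (hgR q hqR)
  have hfA : ∀ x ∈ biball T a b (l + 1 + 1), f x = g x := by
    intro x hx
    by_cases hxh : x ∈ halfTree T p q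
    · exact hf₁ x hxh
    · rw [hf₂ x hxh, hgR x (hAR x hx hxh)]
  have hfA' : ∀ x ∈ biball T a' b' (l' + 1), f x = x := by
    intro x hx
    by_cases hxh : x ∈ halfTree T p q
    · rw [hf₁ x hxh, hgR x (hAR' x hx hxh)]
    · exact hf₂ x hxh
  have hftype : ∀ v, τ (f v) = τ v :=
    type_apply_of_type_apply hTt (c := c) (by rw [hfA c (hRA hc), hgR c hc])
  have hpar := ((mem_raduGroup_iff hTt i).1 hg).2
  obtain ⟨h, hh, hhf⟩ := exists_mem_raduGroup_eqOn_biball hT hdeg i Y₀ Y₁ hftype hab hab'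
    (n := l + 1 + 1) (n' := l' + 1)
    (by rw [mem_biball, SimpleGraph.dist_self, SimpleGraph.dist_comm]; omega)
    (fun j u hB => parityCondition_of_eqOn hTt hB hfA (hpar j u))
    (fun j u hB => parityCondition_of_eqOn hTt hB (g := 1) hfA' fun _ => i.sgn_one _)
  exact ⟨h, hh, fun x hx => (hhf x (Or.inr hx)).trans (hfA' x hx),
    fun x hx => (hhf x (Or.inl hx)).trans (hfA x hx)⟩

end Consequences

/-! ### Pointwise fixators -/

section Fixators

variable {V : Type*} {T : SimpleGraph V} {τ : T.Coloring (Fin 2)} {d : Fin 2 → ℕ}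

theorem mem_fixator_iff {G : Subgroup (T ≃g T)} {A : Set V} {g : G} :
    g ∈ fixingSubgroup G A ↔ ∀ x ∈ A, (g : T ≃g T) x = x :=
  mem_fixingSubgroup_iff G

theorem fixator_anti {G : Subgroup (T ≃g T)} {A B : Set V} (h : A ⊆ B) :
    fixingSubgroup G B ≤ fixingSubgroup G A := fun _ hg =>
  mem_fixator_iff.2 fun x hx => mem_fixator_iff.1 hg x (h hx)

theorem conj_smul_fixator {G : Subgroup (T ≃g T)} (g : G) (A : Set V) :
    MulAut.conj g • fixingSubgroup G A = fixingSubgroup G ((g : T ≃g T) '' A) := by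
  ext h
  rw [Subgroup.mem_pointwise_smul_iff_inv_smul_mem, mem_fixator_iff, mem_fixator_iff,
    Set.forall_mem_image]
  refine forall₂_congr fun x _ => ?_
  have : (((MulAut.conj g)⁻¹ • h : G) : T ≃g T) x =
      (g : T ≃g T).symm ((h : T ≃g T) ((g : T ≃g T) x)) := by
    rw [← map_inv, MulAut.smul_def, MulAut.conj_apply, inv_inv]
    rfl
  rw [this]
  exact (RelIso.symm_apply_eq _)

/-- An element agreeing on `A` with an element that fixes `A'` lies in the product of the
fixators. -/
theorem mem_mul_fixator {G : Subgroup (T ≃g T)} {A A' : Set V} {g h : G}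
    (hA' : ∀ x ∈ A', (h : T ≃g T) x = x) (hA : ∀ x ∈ A, (h : T ≃g T) x = (g : T ≃g T) x) :
    g ∈ (fixingSubgroup G A' : Set G) * (fixingSubgroup G A : Set G) := by
  rw [← mul_inv_cancel_left h g]
  refine Set.mul_mem_mul (mem_fixator_iff.2 hA') (mem_fixator_iff.2 fun x hx => ?_)
  change (h : T ≃g T).symm ((g : T ≃g T) x) = x
  rw [← hA x hx]
  exact RelIso.symm_apply_apply _ _

theorem mem_transporter_iff {G : Subgroup (T ≃g T)} {U W : Subgroup G} {g : G} :
    g ∈ transporter U W ↔ W ≤ MulAut.conj g • U := by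
  refine forall₂_congr fun v _ => ?_
  rw [Subgroup.mem_pointwise_smul_iff_inv_smul_mem, ← map_inv, MulAut.smul_def, MulAut.conj_apply,
    inv_inv]

theorem mem_fixatorFiltration_iff (hT : T.IsTree) {G : Subgroup (T ≃g T)} {U : Subgroup G} :
    U ∈ fixatorFiltration G ↔ ∃ l A, IsBallOfDepth T A l ∧ U = fixingSubgroup G A := by
  constructor
  · rintro ⟨A, hA, rfl⟩
    obtain ⟨l, hl⟩ := (mem_subtreeFamily_iff hT).1 hA
    exact ⟨l, A, hl, rfl⟩
  · rintro ⟨l, A, hA, rfl⟩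
    exact ⟨A, (mem_subtreeFamily_iff hT).2 ⟨l, hA⟩, rfl⟩

theorem fixator_le_fixator_iff (hT : IsSemiRegularTree T τ d) (hdeg : HasDegreeGeFour T)
    (i : LegalColoring T τ d) (Y₀ Y₁ : Finset ℕ) {A A' : Set V} {l : ℕ}
    (hA' : IsBallOfDepth T A' l) :
    fixingSubgroup (raduGroup hT.isTree i Y₀ Y₁) A' ≤
      fixingSubgroup (raduGroup hT.isTree i Y₀ Y₁) A ↔ A ⊆ A' := by
  refine ⟨fun h y hy => ?_, fixator_anti⟩
  obtain ⟨a, b, hab, -, rfl⟩ := hA'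
  by_contra hcon
  obtain ⟨g, hg, hgA, hgy⟩ := exists_fixing_biball_ne hT hdeg i Y₀ Y₁ hab (by omega) hcon
  exact hgy (mem_fixator_iff.1 (@h ⟨g, hg⟩ (mem_fixator_iff.2 hgA)) y hy)

end Fixators

/-! ### Depth and height -/

section Depth

variable {V : Type*} {T : SimpleGraph V} {τ : T.Coloring (Fin 2)} {d : Fin 2 → ℕ}

theorem IsBallOfDepth.exists_subset_of_le (hT : T.IsTree) (hdeg : HasDegreeGeFour T) {l n : ℕ}
    (hn : n ≤ l) : ∀ {A : Set V}, IsBallOfDepth T A l → ∃ R ⊆ A, IsBallOfDepth T R n := by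
  induction hn with
  | refl => exact fun {A} hA => ⟨A, subset_rfl, hA⟩
  | step _ ih =>
    intro A hA
    obtain ⟨R, hRA, hR⟩ := hA.exists_subset hT hdeg
    obtain ⟨R', hR'R, hR'⟩ := ih hR
    exact ⟨R', hR'R.trans hRA, hR'⟩

/-- The height of the class of the fixator of a ball is the depth of the ball: by the inclusion of
balls the depth is strictly monotone on classes, and below a ball of depth `l` there are balls of
all smaller depths. -/
theorem height_mk_fixator (hT : IsSemiRegularTree T τ d) (hdeg : HasDegreeGeFour T)
    (i : LegalColoring T τ d) (Y₀ Y₁ : Finset ℕ) {A : Set V} {l : ℕ} (hA : IsBallOfDepth T A l)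
    (hU : fixingSubgroup (raduGroup hT.isTree i Y₀ Y₁) A ∈
      fixatorFiltration (raduGroup hT.isTree i Y₀ Y₁)) :
    Order.height (ClassPoset.mk _ hU) = l := by
  have hTt := hT.isTree
  set G := raduGroup hTt i Y₀ Y₁
  have hex : ∀ C : ClassPoset (fixatorFiltration G), ∃ l A, IsBallOfDepth T A l ∧
      C.1 = conjClass (fixingSubgroup G A) := by
    rintro ⟨C, U, hU, rfl⟩
    obtain ⟨l, A, hA, rfl⟩ := (mem_fixatorFiltration_iff hTt).1 hU
    exact ⟨l, A, hA, rfl⟩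
  -- comparison of classes in terms of balls
  have hle : ∀ {C D : ClassPoset (fixatorFiltration G)} {l m A B}, IsBallOfDepth T A l →
      IsBallOfDepth T B m → C.1 = conjClass (fixingSubgroup G A) →
      D.1 = conjClass (fixingSubgroup G B) → C ≤ D → l ≤ m ∧ (l = m → D ≤ C) := by
    rintro C D l m A B hA hB hC hD ⟨U, hU, W, hW, hWU⟩
    have hU' := hU
    have hW' := hW
    rw [hC] at hU'
    rw [hD] at hW'
    obtain ⟨g, rfl⟩ := hU'
    obtain ⟨h, rfl⟩ := hW'
    rw [conj_smul_fixator, conj_smul_fixator] at hWU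
    obtain ⟨h1, h2⟩ := (hA.image hTt g).le_of_subset hTt hdeg (hB.image hTt h)
      ((fixator_le_fixator_iff hT hdeg i Y₀ Y₁ (hB.image hTt h)).1 hWU)
    refine ⟨h1, fun hlm => ⟨_, hW, _, hU, ?_⟩⟩
    rw [conj_smul_fixator, conj_smul_fixator, h2 hlm]
  choose r ball hball hclass using hex
  have hmono : StrictMono r := by
    intro C D hCD
    obtain ⟨h1, h2⟩ := hle (hball C) (hball D) (hclass C) (hclass D) hCD.le
    exact lt_of_le_of_ne h1 fun h => hCD.not_ge (h2 h)
  have hr : ∀ {C : ClassPoset (fixatorFiltration G)} {l A}, IsBallOfDepth T A l →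
      C.1 = conjClass (fixingSubgroup G A) → r C = l := by
    intro C l A hA hC
    exact le_antisymm (hle (hball C) hA (hclass C) hC le_rfl).1
      (hle hA (hball C) hC (hclass C) le_rfl).1
  have hbelow : ∀ C : ClassPoset (fixatorFiltration G), ∀ n, n < r C → ∃ D, D < C ∧ r D = n := by
    intro C n hn
    obtain ⟨R, hRC, hR⟩ := (hball C).exists_subset_of_le hTt hdeg hn.le
    let D : ClassPoset (fixatorFiltration G) :=
      ClassPoset.mk (fixingSubgroup G R) ((mem_fixatorFiltration_iff hTt).2 ⟨n, R, hR, rfl⟩)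
    have hD : r D = n := hr hR rfl
    refine ⟨D, lt_of_le_not_ge ?_ fun h => ?_, hD⟩
    · exact ⟨_, self_mem_conjClass _, _, by rw [hclass]; exact self_mem_conjClass _,
        fixator_anti hRC⟩
    · have := (hle (hball C) (hball D) (hclass C) (hclass D) h).1
      omega
  rw [Order.height_eq_of_strictMono r hmono hbelow, Order.height_nat, hr hA rfl]

theorem mem_conjugates_fixatorFiltration_iff (hT : T.IsTree) {G : Subgroup (T ≃g T)}
    {U : Subgroup G} : U ∈ conjugates (fixatorFiltration G) ↔
      ∃ l A, IsBallOfDepth T A l ∧ U = fixingSubgroup G A := by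
  constructor
  · rintro ⟨U, hU, g, rfl⟩
    obtain ⟨l, A, hA, rfl⟩ := (mem_fixatorFiltration_iff hT).1 hU
    exact ⟨l, _, hA.image hT g, conj_smul_fixator g A⟩
  · rintro ⟨l, A, hA, rfl⟩
    exact ⟨_, (mem_fixatorFiltration_iff hT).2 ⟨l, A, hA, rfl⟩, self_mem_conjClass _⟩

theorem mem_depthSet_iff (hT : IsSemiRegularTree T τ d) (hdeg : HasDegreeGeFour T)
    (i : LegalColoring T τ d) (Y₀ Y₁ : Finset ℕ) {l : ℕ}
    {U : Subgroup (raduGroup hT.isTree i Y₀ Y₁)} :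
    U ∈ depthSet (fixatorFiltration (raduGroup hT.isTree i Y₀ Y₁)) l ↔
      ∃ A, IsBallOfDepth T A l ∧ U = fixingSubgroup _ A := by
  constructor
  · rintro ⟨hU, hl⟩
    obtain ⟨m, A, hA, rfl⟩ := (mem_fixatorFiltration_iff hT.isTree).1 hU
    rw [height_mk_fixator hT hdeg i Y₀ Y₁ hA, Nat.cast_inj] at hl
    exact ⟨A, hl ▸ hA, rfl⟩
  · rintro ⟨A, hA, rfl⟩
    exact ⟨(mem_fixatorFiltration_iff hT.isTree).2 ⟨l, A, hA, rfl⟩,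
      height_mk_fixator hT hdeg i Y₀ Y₁ hA _⟩

theorem mem_conjugates_depthSet_iff (hT : IsSemiRegularTree T τ d) (hdeg : HasDegreeGeFour T)
    (i : LegalColoring T τ d) (Y₀ Y₁ : Finset ℕ) {l : ℕ}
    {U : Subgroup (raduGroup hT.isTree i Y₀ Y₁)} :
    U ∈ conjugates (depthSet (fixatorFiltration (raduGroup hT.isTree i Y₀ Y₁)) l) ↔
      ∃ A, IsBallOfDepth T A l ∧ U = fixingSubgroup _ A := by
  constructor
  · rintro ⟨U, hU, g, rfl⟩
    obtain ⟨A, hA, rfl⟩ := (mem_depthSet_iff hT hdeg i Y₀ Y₁).1 hU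
    exact ⟨_, hA.image hT.isTree g, conj_smul_fixator g A⟩
  · rintro ⟨A, hA, rfl⟩
    exact ⟨_, (mem_depthSet_iff hT hdeg i Y₀ Y₁).2 ⟨A, hA, rfl⟩, self_mem_conjClass _⟩

end Depth

/-! ### Compact open fixators -/

section TopologicalGroup

variable {V : Type*} {T : SimpleGraph V} {τ : T.Coloring (Fin 2)} {d : Fin 2 → ℕ}

theorem finite_vertexBall (hfin : ∀ v r, (sphere T v r).Finite) (v : V) (n : ℕ) :
    (vertexBall T v n).Finite := by
  refine ((Set.finite_Iic n).biUnion fun r _ => hfin v r).subset fun x hx => ?_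
  exact Set.mem_biUnion (show T.dist v x ∈ Set.Iic n from hx) rfl

theorem IsBallOfDepth.finite (hfin : ∀ v r, (sphere T v r).Finite) {A : Set V} {l : ℕ}
    (hA : IsBallOfDepth T A l) : A.Finite := by
  obtain ⟨a, b, -, -, rfl⟩ := hA
  refine (finite_vertexBall hfin a (l + 1)).subset fun x hx => ?_
  rw [mem_biball] at hx
  exact le_trans (Nat.le_add_right _ _) hx

variable {G : Subgroup (T ≃g T)}

theorem isClopen_subgroup_apply_mem (v : V) (S : Set V) :
    IsClopen {g : G | (g : T ≃g T) v ∈ S} :=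
  (isClopen_apply_mem v S).preimage continuous_subtype_val

theorem isOpen_fixator {A : Set V} (hA : A.Finite) :
    IsOpen (fixingSubgroup G A : Set G) := by
  have : (fixingSubgroup G A : Set G) = ⋂ x ∈ A, {g : G | (g : T ≃g T) x ∈ ({x} : Set V)} := by
    ext g
    rw [SetLike.mem_coe, mem_fixator_iff]
    simp
  rw [this]
  exact hA.isOpen_biInter fun x _ => (isClopen_subgroup_apply_mem x _).2

theorem isCompact_subgroup_apply_eq (hT : T.IsTree) (hfin : ∀ v r, (sphere T v r).Finite)
    (hG : IsClosed (G : Set (T ≃g T))) (v w : V) : IsCompact {g : G | (g : T ≃g T) v = w} :=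
  hG.isClosedEmbedding_subtypeVal.isCompact_preimage (isCompact_apply_eq hT hfin v w)

theorem isCompact_fixator (hT : T.IsTree) (hfin : ∀ v r, (sphere T v r).Finite)
    (hG : IsClosed (G : Set (T ≃g T))) {A : Set V} (hA : A.Nonempty) :
    IsCompact (fixingSubgroup G A : Set G) := by
  obtain ⟨a, ha⟩ := hA
  have : (fixingSubgroup G A : Set G) = ⋂ x ∈ A, {g : G | (g : T ≃g T) x ∈ ({x} : Set V)} := by
    ext g
    rw [SetLike.mem_coe, mem_fixator_iff]
    simp
  refine (isCompact_subgroup_apply_eq hT hfin hG a a).of_isClosed_subset ?_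
    fun g hg => mem_fixator_iff.1 hg a ha
  rw [this]
  exact isClosed_biInter fun x _ => (isClopen_subgroup_apply_mem x _).1

theorem exists_fixator_subset (hT : T.IsTree) {t : Set G} (ht : t ∈ nhds 1) :
    ∃ U ∈ fixatorFiltration G, (U : Set G) ⊆ t := by
  obtain ⟨c⟩ := hT.connected.nonempty
  rw [nhds_subtype_eq_comap, Filter.mem_comap] at ht
  obtain ⟨s, hs, hst⟩ := ht
  rw [nhds_aut_eq, (Filter.hasBasis_iInf_principal_finite _).mem_iff] at hs
  obtain ⟨F, hF, hFs⟩ := hs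
  obtain ⟨n, hn⟩ := (hF.image (T.dist c)).bddAbove
  refine ⟨_, ⟨vertexBall T c (n + 1), Or.inl ⟨c, n + 1, by omega, rfl⟩, rfl⟩, fun g hg => ?_⟩
  refine hst (hFs (Set.mem_iInter₂.2 fun v hv => ?_))
  refine mem_fixator_iff.1 hg v ?_
  exact (hn (Set.mem_image_of_mem _ hv)).trans (Nat.le_succ n)

theorem isCompact_transporter_fixator (hT : IsSemiRegularTree T τ d) (hdeg : HasDegreeGeFour T)
    (i : LegalColoring T τ d) (Y₀ Y₁ : Finset ℕ) {A A' : Set V} {l : ℕ} (hA : A.Nonempty)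
    (hA' : IsBallOfDepth T A' l) :
    IsCompact (transporter (fixingSubgroup (raduGroup hT.isTree i Y₀ Y₁) A)
      (fixingSubgroup (raduGroup hT.isTree i Y₀ Y₁) A')) := by
  have hTt := hT.isTree
  obtain ⟨a, ha⟩ := hA
  have hmem : ∀ g : raduGroup hTt i Y₀ Y₁,
      g ∈ transporter (fixingSubgroup (raduGroup hTt i Y₀ Y₁) A)
        (fixingSubgroup (raduGroup hTt i Y₀ Y₁) A') ↔ ∀ x ∈ A, (g : T ≃g T) x ∈ A' := by
    intro g
    rw [mem_transporter_iff, conj_smul_fixator, fixator_le_fixator_iff hT hdeg i Y₀ Y₁ hA',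
      Set.image_subset_iff]
    rfl
  have hfin := i.finite_sphere hTt
  refine ((hA'.finite hfin).isCompact_biUnion fun y _ => isCompact_subgroup_apply_eq hTt hfin
    (isClosed_raduGroup hTt i Y₀ Y₁) a y).of_isClosed_subset ?_ fun g hg =>
      Set.mem_biUnion ((hmem g).1 hg a ha) rfl
  have : transporter (fixingSubgroup (raduGroup hTt i Y₀ Y₁) A)
        (fixingSubgroup (raduGroup hTt i Y₀ Y₁) A') =
      ⋂ x ∈ A, {g : raduGroup hTt i Y₀ Y₁ | (g : T ≃g T) x ∈ A'} := by
    ext g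
    rw [hmem]
    simp
  rw [this]
  exact isClosed_biInter fun x _ => (isClopen_subgroup_apply_mem x _).1

theorem not_discreteTopology_raduGroup (hT : IsSemiRegularTree T τ d) (hdeg : HasDegreeGeFour T)
    (i : LegalColoring T τ d) (Y₀ Y₁ : Finset ℕ) :
    ¬ DiscreteTopology (raduGroup hT.isTree i Y₀ Y₁) := by
  intro hdisc
  have hTt := hT.isTree
  obtain ⟨U, hU, hU1⟩ := exists_fixator_subset hTt
    ((isOpen_discrete ({1} : Set (raduGroup hTt i Y₀ Y₁))).mem_nhds rfl)
  obtain ⟨l, A, ⟨a, b, hab, hl, rfl⟩, rfl⟩ := (mem_fixatorFiltration_iff hTt).1 hU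
  obtain ⟨w, z, _, -, -, -, -, hz⟩ := exists_outward hTt hdeg hab hab a (l + 1)
  have hza := (hz z (Or.inl rfl)).1
  have hzn : z ∉ biball T a b (l + 1) := by
    rw [mem_biball]
    omega
  obtain ⟨g, hg, hgA, hgz⟩ := exists_fixing_biball_ne hT hdeg i Y₀ Y₁ hab (by omega) hzn
  have h1 := hU1 (show (⟨g, hg⟩ : raduGroup hTt i Y₀ Y₁) ∈ _ from mem_fixator_iff.2 hgA)
  have h2 : g = 1 := congrArg Subtype.val h1
  exact hgz (by rw [h2]; rfl)

end TopologicalGroup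

/-! ### Unimodularity -/

section Unimodular

open MeasureTheory MeasureTheory.Measure

/-- The modular character is trivial on compact open subgroups. -/
theorem modularCharacterFun_eq_one_of_mem {G : Type*} [Group G] [TopologicalSpace G]
    [IsTopologicalGroup G] [LocallyCompactSpace G] {K : Subgroup G} (hK : IsOpen (K : Set G))
    (hK' : IsCompact (K : Set G)) {g : G} (hg : g ∈ K) : modularCharacterFun g = 1 := by
  borelize G
  let ν : Measure G := haar
  have hreg : Regular (map (· * g) ν) := Regular.map (Homeomorph.mulRight g)
  have h1 : map (· * g) ν = modularCharacterFun g • ν := by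
    rw [modularCharacterFun_eq_haarScalarFactor ν]
    exact isMulLeftInvariant_eq_smul_of_regular _ ν
  have h2 : map (· * g) ν (K : Set G) = ν (K : Set G) := by
    rw [map_apply (measurable_mul_const g) hK.measurableSet]
    congr 1
    ext x
    exact K.mul_mem_cancel_right hg
  rw [h1, Measure.smul_apply, ENNReal.smul_def, smul_eq_mul] at h2
  have h3 : ν (K : Set G) ≠ 0 := (hK.measure_pos ν ⟨1, K.one_mem⟩).ne'
  have h4 : ν (K : Set G) ≠ ⊤ := hK'.measure_lt_top.ne
  have h5 := (ENNReal.mul_eq_right h3 h4).1 h2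
  exact_mod_cast h5

theorem isUnimodular_of_modularCharacterFun_eq_one {G : Type*} [Group G] [TopologicalSpace G]
    [IsTopologicalGroup G] [LocallyCompactSpace G] (h : ∀ g : G, modularCharacterFun g = 1) :
    IsUnimodular G := by
  intro _ _ μ _ _
  refine ⟨fun g => ?_⟩
  have hreg : Regular (map (· * g) μ) := Regular.map (Homeomorph.mulRight g)
  rw [isMulLeftInvariant_eq_smul_of_regular (map (· * g) μ) μ,
    ← modularCharacterFun_eq_haarScalarFactor μ, h, one_smul]

variable {V : Type*} {T : SimpleGraph V} {τ : T.Coloring (Fin 2)} {d : Fin 2 → ℕ}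

/-- The group is generated by its vertex stabilizers, which are compact and open: by local
transitivity they act transitively on the vertices of each type. -/
theorem isUnimodular_raduGroup (hT : IsSemiRegularTree T τ d) (hdeg : HasDegreeGeFour T)
    (i : LegalColoring T τ d) (Y₀ Y₁ : Finset ℕ)
    [LocallyCompactSpace (raduGroup hT.isTree i Y₀ Y₁)] :
    IsUnimodular (raduGroup hT.isTree i Y₀ Y₁) := by
  have hTt := hT.isTree
  have hstab : ∀ (g : raduGroup hTt i Y₀ Y₁) (v : V), (g : T ≃g T) v = v →
      modularCharacterFun g = 1 := by
    intro g v hgv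
    refine modularCharacterFun_eq_one_of_mem (K := fixingSubgroup _ ({v} : Set V))
      (isOpen_fixator (Set.finite_singleton v))
      (isCompact_fixator hTt (i.finite_sphere hTt) (isClosed_raduGroup hTt i Y₀ Y₁)
        (Set.singleton_nonempty v)) (mem_fixator_iff.2 ?_)
    rintro x rfl
    exact hgv
  have htrans : ∀ n v w, T.dist v w = 2 * n → ∃ k : raduGroup hTt i Y₀ Y₁,
      (k : T ≃g T) v = w ∧ modularCharacterFun k = 1 := by
    intro n
    induction n with
    | zero =>
      intro v w h
      obtain rfl := hTt.connected.dist_eq_zero_iff.1 h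
      exact ⟨1, rfl, modularCharacterFun_map_one⟩
    | succ n ih =>
      intro v w h
      have hne : ∀ {x}, 0 < T.dist v x → v ≠ x := by
        rintro x hx rfl
        rw [SimpleGraph.dist_self] at hx
        omega
      obtain ⟨u, hu, hud⟩ := exists_adj_dist_succ hTt (hne (show 0 < T.dist v w by omega))
      obtain ⟨x, hx, hxd⟩ := exists_adj_dist_succ hTt (hne (show 0 < T.dist v u by omega))
      obtain ⟨k, hk, hk1⟩ := ih v x (by omega)
      obtain ⟨g, hg, hgu, hgx⟩ := exists_apply_eq_of_adj hT hdeg i Y₀ Y₁ hx.symm hu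
      refine ⟨⟨g, hg⟩ * k, ?_, ?_⟩
      · change g ((k : T ≃g T) v) = w
        rw [hk, hgx]
      · rw [modularCharacterFun_map_mul, hk1, hstab ⟨g, hg⟩ u hgu, one_mul]
  have hone : ∀ g : raduGroup hTt i Y₀ Y₁, modularCharacterFun g = 1 := by
    intro g
    obtain ⟨v⟩ := hTt.connected.nonempty
    have htype := ((mem_raduGroup_iff hTt i).1 g.2).1 v
    have hdist := type_eq_dist hTt τ v ((g : T ≃g T) v)
    rw [htype] at hdist
    obtain ⟨k, hk, hk1⟩ := htrans (T.dist v ((g : T ≃g T) v) / 2) v ((g : T ≃g T) v) (by omega)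
    have h1 : modularCharacterFun (k⁻¹ * g) = 1 := by
      refine hstab _ v ?_
      change (k : T ≃g T).symm ((g : T ≃g T) v) = v
      rw [← hk]
      exact RelIso.symm_apply_apply _ _
    rw [← mul_inv_cancel_left k g, modularCharacterFun_map_mul, hk1, h1, one_mul]
  exact @isUnimodular_of_modularCharacterFun_eq_one _ _ _ _ _ hone

end Unimodular

end RaduTree

open RaduTree

theorem mainTheorem5 {V : Type*} (T : SimpleGraph V) (τ : T.Coloring (Fin 2)) (d : Fin 2 → ℕ)
    (hd : ∀ t, 4 ≤ d t) (hT : RaduTree.IsSemiRegularTree T τ d)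
    (i : RaduTree.LegalColoring T τ d) (Y₀ Y₁ : Finset ℕ)
    (G : Subgroup (T ≃g T)) (hG : G = RaduTree.raduGroup hT.isTree i Y₀ Y₁) :
    (T2Space G ∧ SecondCountableTopology G ∧ LocallyCompactSpace G ∧
      TotallyDisconnectedSpace G ∧ ¬ DiscreteTopology G ∧
      RaduTree.IsUnimodular G) ∧
    RaduTree.IsGenericFiltration (RaduTree.fixatorFiltration G) ∧
    ∀ l : ℕ, 1 ≤ l → RaduTree.FactorizesPlusAt (RaduTree.fixatorFiltration G) l := by
  subst hG
  have hdeg := hT.hasDegreeGeFour hd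
  have hTt := hT.isTree
  have hfin := i.finite_sphere hTt
  have hclosed := isClosed_raduGroup hTt i Y₀ Y₁
  have hsep : TotallySeparatedSpace (T ≃g T) := totallySeparatedSpace_aut
  have hcount : Countable V := countable_of_finite_sphere hTt hfin
  have hsecond : SecondCountableTopology (T ≃g T) := secondCountableTopology_aut
  have hopen : ∀ U ∈ fixatorFiltration (raduGroup hTt i Y₀ Y₁),
      IsOpen (U : Set (raduGroup hTt i Y₀ Y₁)) := by
    intro U hU
    obtain ⟨l, A, hA, rfl⟩ := (mem_fixatorFiltration_iff hTt).1 hU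
    exact isOpen_fixator (hA.finite hfin)
  have hcompact : ∀ U ∈ fixatorFiltration (raduGroup hTt i Y₀ Y₁),
      IsCompact (U : Set (raduGroup hTt i Y₀ Y₁)) := by
    intro U hU
    obtain ⟨l, A, hA, rfl⟩ := (mem_fixatorFiltration_iff hTt).1 hU
    exact isCompact_fixator hTt hfin hclosed hA.nonempty
  have hloc : LocallyCompactSpace (raduGroup hTt i Y₀ Y₁) := by
    obtain ⟨U, hU, -⟩ := exists_fixator_subset hTt
      (Filter.univ_mem : Set.univ ∈ nhds (1 : raduGroup hTt i Y₀ Y₁))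
    exact (hcompact U hU).locallyCompactSpace_of_mem_nhds_of_group
      ((hopen U hU).mem_nhds U.one_mem)
  refine ⟨⟨inferInstance, Topology.IsInducing.subtypeVal.secondCountableTopology, hloc,
    inferInstance, not_discreteTopology_raduGroup hT hdeg i Y₀ Y₁,
    isUnimodular_raduGroup hT hdeg i Y₀ Y₁⟩,
    ⟨hopen, hcompact, ?_, ?_⟩, ?_⟩
  · refine ⟨fun t => ⟨exists_fixator_subset hTt, ?_⟩⟩
    rintro ⟨U, hU, hUt⟩
    exact Filter.mem_of_superset ((hopen U hU).mem_nhds U.one_mem) hUt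
  · rintro ⟨C, U, hU, rfl⟩
    obtain ⟨l, A, hA, rfl⟩ := (mem_fixatorFiltration_iff hTt).1 hU
    have := height_mk_fixator hT hdeg i Y₀ Y₁ hA hU
    intro htop
    exact ENat.natCast_ne_top l (this.symm.trans htop)
  · intro l hl
    obtain ⟨l, rfl⟩ := Nat.exists_eq_add_of_le' hl
    refine ⟨⟨?_, ?_⟩, ?_⟩
    · intro U hU W hW hWU
      obtain ⟨A, hA, rfl⟩ := (mem_depthSet_iff hT hdeg i Y₀ Y₁).1 hU
      obtain ⟨l', A', hA', rfl⟩ := (mem_conjugates_fixatorFiltration_iff hTt).1 hW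
      rw [fixator_le_fixator_iff hT hdeg i Y₀ Y₁ hA'] at hWU
      obtain ⟨R, hR, hRA, hfac⟩ := exists_factorization hT hdeg i Y₀ Y₁ hA hA' hWU
      refine ⟨fixingSubgroup _ R, (mem_conjugates_depthSet_iff hT hdeg i Y₀ Y₁).2 ⟨R, hR, rfl⟩,
        fixator_anti hRA, ?_⟩
      rintro ⟨g, hg⟩ hgR
      obtain ⟨h, hh, hhA', hhA⟩ := hfac g hg (mem_fixator_iff.1 hgR)
      exact mem_mul_fixator (h := ⟨h, hh⟩) hhA' hhA
    · intro U hU W hW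
      obtain ⟨A, hA, rfl⟩ := (mem_depthSet_iff hT hdeg i Y₀ Y₁).1 hU
      obtain ⟨l', A', hA', rfl⟩ := (mem_conjugates_fixatorFiltration_iff hTt).1 hW
      exact isCompact_transporter_fixator hT hdeg i Y₀ Y₁ hA.nonempty hA'
    · intro U hU W hW hUW g hgW
      obtain ⟨A, hA, rfl⟩ := (mem_depthSet_iff hT hdeg i Y₀ Y₁).1 hU
      obtain ⟨R, hR, rfl⟩ := (mem_conjugates_depthSet_iff hT hdeg i Y₀ Y₁).1 hW
      rw [fixator_le_fixator_iff hT hdeg i Y₀ Y₁ hA] at hUW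
      obtain ⟨a, b, hab, hpar, rfl⟩ := hA
      -- `g` fixes the center of `A`, and therefore preserves `A`
      obtain ⟨haR, hbR⟩ := center_mem_of_subset hTt hdeg hR hab hpar hUW
      have hg := mem_fixator_iff.1 hgW
      rw [mem_transporter_iff, conj_smul_fixator, image_biball hTt, hg a haR, hg b hbR]
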